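/- All graphs are finite, simple and undirected. An independent cut of a graph $G$ is a (possibly empty) independent set $S$ of vertices of $G$ such that $G-S$ is disconnected. The problem Independent Cut (IC) is to decide, for a given graph $G$, whether $G$ has an independent cut. For an integer $\Delta\ge 0$ let $\alpha_\Delta=\frac{1}{2+4\lfloor\Delta/2\rfloor}$. The notation $\mathcal O^*(f(n))$ stands for an upper bound of the form $p(n)\,f(n)$ with a polynomial $p$. There is an algorithm (a fixed program for a random access machine, whose elementary steps are counted, with the order of the graph and its adjacency matrix as input) that decides IC for every graph, and that runs in $\mathcal O^*\bigl(2^{(1/2-\alpha_\Delta)n}\bigr)$ time on graphs of order $n$ and maximum degree at most $\Delta$, with a polynomial factor in $n$ that does not depend on $\Delta$. In particular, IC on any graph of order $n$ is decided in $\mathcal O^*\bigl(\sqrt2^{\,n}\bigr)$ time. -/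

import Mathlib

namespace IndependentCut

/-! ### The decision problem -/

/-- `G` has an independent cut: an independent vertex set `S` (possibly empty) such that `G - S` is
disconnected, i.e. contains two vertices that no path joins.  (A graph without vertices is not
disconnected, hence `Preconnected` and not `Connected`.) -/
def HasIndependentCut {V : Type*} (G : SimpleGraph V) : Prop :=
  ∃ S : Set V, G.IsIndepSet S ∧ ¬ (G.induce Sᶜ).Preconnected

/-- The number `α_Δ = 1 / (2 + 4 ⌊Δ / 2⌋)`; the division `Δ / 2` is the one of natural numbers,
so it is rounded down. -/
noncomputable def alpha (Δ : ℕ) : ℝ := 1 / (2 + 4 * ((Δ / 2 : ℕ) : ℝ))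

/-! ### The machine model

A random access machine, programmed by structured programs: there are registers and arrays
(both numbered by natural numbers, arrays are addressed indirectly), all of them hold natural
numbers.  The available operations never produce a number larger than one plus the largest of
their arguments (in particular there is no addition or multiplication of registers at unit cost),
so that after `t` steps all numbers have `O(log (t + input))` bits and unit costs are realistic. -/

/-- The memory: the contents of the registers and of the arrays. -/
structure Store where
  reg : ℕ → ℕ
  arr : ℕ → ℕ → ℕ

/-- Expressions: constants, registers, array entries `a[i]`, successor, truncated subtraction and
comparisons. -/
inductive Expr : Type
  | const (c : ℕ)
  | var (x : ℕ)
  | get (a : ℕ) (i : Expr)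
  | succ (e : Expr)
  | sub (e f : Expr)
  | eq (e f : Expr)
  | lt (e f : Expr)

/-- The value of an expression; comparisons yield `1` for true and `0` for false. -/
def Expr.eval (s : Store) : Expr → ℕ
  | const c => c
  | var x => s.reg x
  | get a i => s.arr a (i.eval s)
  | succ e => e.eval s + 1
  | sub e f => e.eval s - f.eval s
  | eq e f => if e.eval s = f.eval s then 1 else 0
  | lt e f => if e.eval s < f.eval s then 1 else 0

/-- The number of elementary operations in the evaluation of an expression. -/
def Expr.cost : Expr → ℕ
  | const _ => 1
  | var _ => 1
  | get _ i => i.cost + 1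
  | succ e => e.cost + 1
  | sub e f => e.cost + f.cost + 1
  | eq e f => e.cost + f.cost + 1
  | lt e f => e.cost + f.cost + 1

/-- Programs.  `assign x e` is `x := e`, `write a i e` is `a[i] := e`, `seq` is sequential
composition, `ite e c d` executes `c` if `e ≠ 0` and `d` otherwise, and `loop e c` is
`while e ≠ 0 do c`. -/
inductive Program : Type
  | skip
  | assign (x : ℕ) (e : Expr)
  | write (a : ℕ) (i e : Expr)
  | seq (c d : Program)
  | ite (e : Expr) (c d : Program)
  | loop (e : Expr) (c : Program)

/-- Put `v` into register `x`. -/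
def Store.setReg (s : Store) (x v : ℕ) : Store :=
  { s with reg := Function.update s.reg x v }

/-- Put `v` into entry `i` of array `a`. -/
def Store.setArr (s : Store) (a i v : ℕ) : Store :=
  { s with arr := Function.update s.arr a (Function.update (s.arr a) i v) }

/-- `Run c s s' t`: the program `c`, started with memory `s`, halts after exactly `t` steps,
and its memory is `s'` then. -/
inductive Run : Program → Store → Store → ℕ → Prop
  | skip (s : Store) : Run .skip s s 1
  | assign (x : ℕ) (e : Expr) (s : Store) :
      Run (.assign x e) s (s.setReg x (e.eval s)) (e.cost + 1)
  | write (a : ℕ) (i e : Expr) (s : Store) :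
      Run (.write a i e) s (s.setArr a (i.eval s) (e.eval s)) (i.cost + e.cost + 1)
  | seq {c d : Program} {s s' s'' : Store} {t t' : ℕ} :
      Run c s s' t → Run d s' s'' t' → Run (.seq c d) s s'' (t + t')
  | iteTrue {e : Expr} {c d : Program} {s s' : Store} {t : ℕ} :
      e.eval s ≠ 0 → Run c s s' t → Run (.ite e c d) s s' (e.cost + 1 + t)
  | iteFalse {e : Expr} {c d : Program} {s s' : Store} {t : ℕ} :
      e.eval s = 0 → Run d s s' t → Run (.ite e c d) s s' (e.cost + 1 + t)
  | loopDone {e : Expr} {c : Program} {s : Store} :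
      e.eval s = 0 → Run (.loop e c) s s (e.cost + 1)
  | loopStep {e : Expr} {c : Program} {s s' s'' : Store} {t t' : ℕ} :
      e.eval s ≠ 0 → Run c s s' t → Run (.loop e c) s' s'' t' →
      Run (.loop e c) s s'' (e.cost + 1 + t + t')

/-- Runs are deterministic: the final memory and the number of steps are determined by the program
and the initial memory. -/
theorem Run.deterministic {c : Program} {s s₁ s₂ : Store} {t₁ t₂ : ℕ}
    (h₁ : Run c s s₁ t₁) (h₂ : Run c s s₂ t₂) : s₁ = s₂ ∧ t₁ = t₂ := by
  induction h₁ generalizing s₂ t₂ with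
  | skip s => cases h₂; exact ⟨rfl, rfl⟩
  | assign x e s => cases h₂; exact ⟨rfl, rfl⟩
  | write a i e s => cases h₂; exact ⟨rfl, rfl⟩
  | seq _ _ ih ih' =>
    cases h₂ with
    | seq k k' =>
      obtain ⟨rfl, rfl⟩ := ih k
      obtain ⟨rfl, rfl⟩ := ih' k'
      exact ⟨rfl, rfl⟩
  | iteTrue h _ ih =>
    cases h₂ with
    | iteTrue _ k => obtain ⟨rfl, rfl⟩ := ih k; exact ⟨rfl, rfl⟩
    | iteFalse h' _ => exact absurd h' h
  | iteFalse h _ ih =>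
    cases h₂ with
    | iteTrue h' _ => exact absurd h h'
    | iteFalse _ k => obtain ⟨rfl, rfl⟩ := ih k; exact ⟨rfl, rfl⟩
  | loopDone h =>
    cases h₂ with
    | loopDone _ => exact ⟨rfl, rfl⟩
    | loopStep h' _ _ => exact absurd h h'
  | loopStep h _ _ ih ih' =>
    cases h₂ with
    | loopDone h' => exact absurd h' h
    | loopStep _ k k' =>
      obtain ⟨rfl, rfl⟩ := ih k
      obtain ⟨rfl, rfl⟩ := ih' k'
      exact ⟨rfl, rfl⟩

/-! ### Deciding the problem on the machine -/

/-- The initial memory for a graph `G` with vertices `0, …, n - 1`: register `0` holds `n`, array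
`0` holds the adjacency matrix row by row (entry `i * n + j` is `1` if `i` and `j` are adjacent),
everything else is `0`. -/
def input {n : ℕ} (G : SimpleGraph (Fin n)) [DecidableRel G.Adj] : Store where
  reg x := if x = 0 then n else 0
  arr a k := if a = 0 ∧ ∃ i j : Fin n, k = i * n + j ∧ G.Adj i j then 1 else 0

/-- On the input `G`, the program `P` halts after at most `T` steps with the correct answer to the
question whether `G` has an independent cut: register `0` is `1` for yes and `0` for no. -/
def DecidesWithin (P : Program) {n : ℕ} (G : SimpleGraph (Fin n)) [DecidableRel G.Adj] (T : ℝ) :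
    Prop :=
  ∃ (s : Store) (t : ℕ), Run P (input G) s t ∧ (t : ℝ) ≤ T ∧
    ((HasIndependentCut G ∧ s.reg 0 = 1) ∨ (¬ HasIndependentCut G ∧ s.reg 0 = 0))

end IndependentCut

/-!
A colouring with the colours `0`, `1`, `2` in which no edge has the colours `1, 1` or `0, 2`
describes an independent set (colour `1`) together with a division of the remaining vertices into
two parts without edges between them.  So an independent cut exists if and only if there is such a
colouring in which both `0` and `2` occur (`hasIndependentCut_iff`).

*Lists of two colours are easy.*  Exclude a pair of colours at two vertices whenever it does not
extend to some third vertex, until nothing changes.  If every vertex has lost a colour by then, each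
remaining pair extends greedily to a colouring, because pairwise intersecting subsets of a set of
two elements have a common element (`exists_coloring`).

*One bit restricts a triangle.*  The vertices of a triangle avoid `0`, or they avoid `2`: at most
one of them has colour `1`, and the others agree.  Moreover, if both `u` and `v` have lost `0` or
`2`, then each common neighbour of the adjacent vertices `u` and `v` loses a colour, too
(`avoids_same`, `avoids_one`).  Hence it suffices to guess one bit for each triangle of a family
such that every other triangle that contains an uncovered vertex has its other two vertices covered.
This requires every vertex to lie in a triangle; a vertex in no triangle has an independent
neighbourhood, which is an independent cut unless the vertex is adjacent to all others
(`cutColorable_of_no_triangle`, `cutColorable_of_consistent`).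

*Few triangles suffice.*  The family consists of disjoint windmills, in which `j` triangles share a
centre and have `2 j + 1` vertices.  The centre has degree at least `2 j`, so `j ≤ ⌊Δ / 2⌋ =: d`,
and there are at most `d n / (1 + 2 d) = (1 / 2 - α_Δ) n` triangles
(`IsWindmills.repCount_le`).  The windmills come from a local search: given a triangle with two
uncovered vertices and the third vertex `v`, add it if `v` is uncovered or a centre.  Otherwise
make `v` the centre of its windmill if that is a single triangle, and else give up the triangle of
`v` at a loss of one vertex, and make `v` the centre of the new triangle.  The number of covered
vertices increases in all cases (`Stmt.improve_spec`).

The machine runs the local search, and then, for each choice of bits, the exclusion of pairs.  All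
parts except the loop over the choices of bits are bounded programs (`Stmt`), for which termination
in polynomial time holds by construction (`Stmt.run_compile`), so that only their effect `Stmt.den`
on the memory remains to be analysed.

The registers are used as follows: `0` and `1` hold `n` and `n * n`, `2` the answer, `3` the carry
of the bit counter, `4` to `8` and `12` loop counters, `9` to `11` intermediate results.  The arrays
are the adjacency matrix `0`, the starts of its rows `1`, the windmills `2` and `3`, the bits `4`,
and the table of excluded pairs for the colours `a` and `b` in `5 + 3 * a + b`.
-/

namespace IndependentCut

section

/-! ### Bounded programs -/

/-- Programs whose only loops are `for i = 0, …, n - 1` with `n` the content of register `0`. -/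
inductive Stmt : Type
  | skip
  | assign (x : ℕ) (e : Expr)
  | write (a : ℕ) (i e : Expr)
  | seq (c d : Stmt)
  | ite (e : Expr) (c d : Stmt)
  | loop (i : ℕ) (c : Stmt)

namespace Stmt

/-- The program that implements a bounded program. -/
def compile : Stmt → Program
  | skip => .skip
  | assign x e => .assign x e
  | write a i e => .write a i e
  | seq c d => .seq c.compile d.compile
  | ite e c d => .ite e c.compile d.compile
  | loop i c => .seq (.assign i (.const 0))
      (.loop (.lt (.var i) (.var 0)) (.seq c.compile (.assign i (.succ (.var i)))))

/-- The memory after the first `k` rounds of a loop over register `i` with body `f`. -/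
def rounds (f : Store → Store) (i : ℕ) (s : Store) : ℕ → Store
  | 0 => s.setReg i 0
  | k + 1 => (f (rounds f i s k)).setReg i (k + 1)

/-- The effect of a bounded program on the memory. -/
def den : Stmt → Store → Store
  | skip, s => s
  | assign x e, s => s.setReg x (e.eval s)
  | write a i e, s => s.setArr a (i.eval s) (e.eval s)
  | seq c d, s => d.den (c.den s)
  | ite e c d, s => if e.eval s ≠ 0 then c.den s else d.den s
  | loop i c, s => rounds c.den i s (s.reg 0)

/-- `c` contains no assignment to register `x`. -/
def keeps (x : ℕ) : Stmt → Bool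
  | skip => true
  | assign y _ => x != y
  | write _ _ _ => true
  | seq c d => c.keeps x && d.keeps x
  | ite _ c d => c.keeps x && d.keeps x
  | loop i c => x != i && c.keeps x

/-- `c` does not write to array `a`. -/
def keepsArr (a : ℕ) : Stmt → Bool
  | skip => true
  | assign _ _ => true
  | write b _ _ => a != b
  | seq c d => c.keepsArr a && d.keepsArr a
  | ite _ c d => c.keepsArr a && d.keepsArr a
  | loop _ c => c.keepsArr a

/-- No loop body changes the counter of its loop. -/
def wf : Stmt → Bool
  | skip => true
  | assign _ _ => true
  | write _ _ _ => true
  | seq c d => c.wf && d.wf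
  | ite _ c d => c.wf && d.wf
  | loop i c => c.keeps i && c.wf

/-- A bound on the running time in terms of the content of register `0`. -/
noncomputable def time : Stmt → Polynomial ℕ
  | skip => 1
  | assign _ e => Polynomial.C (e.cost + 1)
  | write _ i e => Polynomial.C (i.cost + e.cost + 1)
  | seq c d => c.time + d.time
  | ite e c d => Polynomial.C (e.cost + 1) + (c.time + d.time)
  | loop _ c => Polynomial.C 6 + Polynomial.X * (c.time + Polynomial.C 7)

end Stmt

@[simp] theorem Store.setReg_reg (s : Store) (x v y : ℕ) :
    (s.setReg x v).reg y = if y = x then v else s.reg y := by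
  simp [Store.setReg, Function.update_apply]

theorem Store.setReg_reg_of_ne (s : Store) (v : ℕ) {x y : ℕ} (h : y ≠ x) :
    (s.setReg x v).reg y = s.reg y := by simp [h]

@[simp] theorem Store.setReg_arr (s : Store) (x v : ℕ) : (s.setReg x v).arr = s.arr := rfl

@[simp] theorem Store.setArr_reg (s : Store) (a i v : ℕ) : (s.setArr a i v).reg = s.reg := rfl

@[simp] theorem Store.setArr_arr (s : Store) (a i v b : ℕ) :
    (s.setArr a i v).arr b = if b = a then Function.update (s.arr a) i v else s.arr b := by
  simp [Store.setArr, Function.update_apply]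

namespace Stmt

theorem den_reg {c : Stmt} {x : ℕ} (h : c.keeps x = true) (s : Store) :
    (c.den s).reg x = s.reg x := by
  induction c generalizing s with
  | skip => rfl
  | assign y e => simp [keeps] at h; simp [den, h]
  | write => rfl
  | seq c d ihc ihd => simp [keeps] at h; simp [den, ihc h.1, ihd h.2]
  | ite e c d ihc ihd => simp [keeps] at h; simp only [den]; split <;> simp [ihc h.1, ihd h.2]
  | loop i c ih =>
    simp [keeps] at h
    simp only [den]
    induction s.reg 0 with
    | zero => simp [rounds, h.1]
    | succ k ihk => simp [rounds, h.1, ih h.2, ihk]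

theorem den_arr {c : Stmt} {a : ℕ} (h : c.keepsArr a = true) (s : Store) :
    (c.den s).arr a = s.arr a := by
  induction c generalizing s with
  | skip => rfl
  | assign y e => rfl
  | write b i e => simp [keepsArr] at h; simp [den, h]
  | seq c d ihc ihd => simp [keepsArr] at h; simp [den, ihc h.1, ihd h.2]
  | ite e c d ihc ihd => simp [keepsArr] at h; simp only [den]; split <;> simp [ihc h.1, ihd h.2]
  | loop i c ih =>
    simp [keepsArr] at h
    simp only [den]
    induction s.reg 0 with
    | zero => simp [rounds]
    | succ k ihk => simp [rounds, ih h, ihk]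

theorem den_ite_of_eq_zero {e : Expr} {c d : Stmt} {s : Store} (h : e.eval s = 0) :
    (ite e c d).den s = d.den s := by simp [den, h]

theorem den_ite_of_ne_zero {e : Expr} {c d : Stmt} {s : Store} (h : e.eval s ≠ 0) :
    (ite e c d).den s = c.den s := by simp [den, h]

theorem rounds_reg_self (f : Store → Store) (i : ℕ) (s : Store) (k : ℕ) :
    (rounds f i s k).reg i = k := by
  cases k <;> simp [rounds]

theorem rounds_reg_of_ne {c : Stmt} {x i : ℕ} (h : c.keeps x = true) (hx : x ≠ i) (s : Store)
    (k : ℕ) : (rounds c.den i s k).reg x = s.reg x := by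
  induction k with
  | zero => simp [rounds, hx]
  | succ k ih => simp [rounds, hx, den_reg h, ih]

/-- A bounded program halts in polynomial time and has the effect `den`. -/
theorem run_compile {c : Stmt} (h : c.wf = true) (h0 : c.keeps 0 = true) (s : Store) :
    ∃ t, Run c.compile s (c.den s) t ∧ t ≤ c.time.eval (s.reg 0) := by
  induction c generalizing s with
  | skip => exact ⟨1, .skip s, by simp [time]⟩
  | assign x e => exact ⟨_, .assign x e s, by simp [time]⟩
  | write a i e => exact ⟨_, .write a i e s, by simp [time]⟩
  | seq c d ihc ihd =>
    simp [wf] at h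
    simp [keeps] at h0
    obtain ⟨t, ht, hle⟩ := ihc h.1 h0.1 s
    obtain ⟨t', ht', hle'⟩ := ihd h.2 h0.2 (c.den s)
    rw [den_reg h0.1] at hle'
    exact ⟨_, ht.seq ht', by simp [time]; omega⟩
  | ite e c d ihc ihd =>
    simp [wf] at h
    simp [keeps] at h0
    obtain ⟨t, ht, hle⟩ := ihc h.1 h0.1 s
    obtain ⟨t', ht', hle'⟩ := ihd h.2 h0.2 s
    by_cases he : e.eval s = 0
    · exact ⟨_, by simpa [den, he, compile] using Run.iteFalse he ht', by simp [time]; omega⟩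
    · exact ⟨_, by simpa [den, he, compile] using Run.iteTrue he ht, by simp [time]; omega⟩
  | loop i c ih =>
    simp [wf] at h
    simp [keeps] at h0
    have key : ∀ m k, k + m = s.reg 0 → ∃ t,
        Run (.loop (.lt (.var i) (.var 0)) (.seq c.compile (.assign i (.succ (.var i)))))
          (rounds c.den i s k) (rounds c.den i s (s.reg 0)) t ∧
        t ≤ 4 + m * (c.time.eval (s.reg 0) + 7) := by
      intro m
      induction m with
      | zero =>
        intro k hk
        obtain rfl : k = s.reg 0 := by omega
        refine ⟨_, Run.loopDone ?_, by simp [Expr.cost]⟩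
        simp [Expr.eval, rounds_reg_self, rounds_reg_of_ne h0.2 h0.1]
      | succ m ihm =>
        intro k hk
        obtain ⟨t, ht, hle⟩ := ih h.2 h0.2 (rounds c.den i s k)
        obtain ⟨t', ht', hle'⟩ := ihm (k + 1) (by omega)
        rw [rounds_reg_of_ne h0.2 h0.1] at hle
        have h1 : Run (.seq c.compile (.assign i (.succ (.var i)))) (rounds c.den i s k)
            (rounds c.den i s (k + 1)) (t + 3) := by
          have := ht.seq (Run.assign i (.succ (.var i)) _)
          simpa [Expr.eval, den_reg h.1, rounds_reg_self, rounds, Expr.cost] using this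
        refine ⟨_, Run.loopStep ?_ h1 ht', ?_⟩
        · simp only [Expr.eval, rounds_reg_self, rounds_reg_of_ne h0.2 h0.1]
          rw [if_pos (by omega)]; simp
        · simp only [Expr.cost]
          rw [add_mul]; omega
    obtain ⟨t, ht, hle⟩ := key (s.reg 0) 0 (by omega)
    refine ⟨_, (Run.assign i (.const 0) s).seq ht, ?_⟩
    simp [time, Expr.cost]
    omega

/-- Induction over the rounds of a loop. -/
theorem den_loop_induction {i : ℕ} {c : Stmt} {s : Store} (I : ℕ → Store → Prop)
    (h0 : I 0 (s.setReg i 0))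
    (h : ∀ k s', k < s.reg 0 → s'.reg i = k → I k s' → I (k + 1) ((c.den s').setReg i (k + 1))) :
    I (s.reg 0) ((loop i c).den s) := by
  have : ∀ k, k ≤ s.reg 0 → I k (rounds c.den i s k) := by
    intro k
    induction k with
    | zero => intro _; exact h0
    | succ k ih => intro hk; exact h k _ (by omega) (rounds_reg_self ..) (ih (by omega))
  exact this _ le_rfl

/-- The bounded programs of a list, executed one after the other. -/
def seqs : List Stmt → Stmt
  | [] => skip
  | c :: l => seq c (seqs l)

end Stmt

/-! ### Derived expressions -/

namespace Expr

/-- `e ≠ 0` and `f ≠ 0`. -/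
def and (e f : Expr) : Expr := .lt (.eq e (.const 0)) (.lt (.const 0) f)

/-- `e ≠ 0` or `f ≠ 0`. -/
def or (e f : Expr) : Expr := .lt (.const 0) (.sub (.succ (.lt (.const 0) f)) (.eq e (.const 0)))

/-- `e = 0`. -/
def not (e : Expr) : Expr := .eq e (.const 0)

/-- The sum of `e` and `f`, provided that it is at most the content of register `1`. -/
def add (e f : Expr) : Expr := .sub (.var 1) (.sub (.sub (.var 1) e) f)

variable (s : Store) (e f : Expr)

@[simp] theorem const_eval (c : ℕ) : (const c).eval s = c := rfl

@[simp] theorem var_eval (x : ℕ) : (var x).eval s = s.reg x := rfl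

@[simp] theorem get_eval (a : ℕ) : (get a e).eval s = s.arr a (e.eval s) := rfl

@[simp] theorem succ_eval : (succ e).eval s = e.eval s + 1 := rfl

@[simp] theorem sub_eval : (sub e f).eval s = e.eval s - f.eval s := rfl

@[simp] theorem eq_eval : (eq e f).eval s = 0 ↔ e.eval s ≠ f.eval s := by
  change (if e.eval s = f.eval s then 1 else 0) = 0 ↔ _
  grind

@[simp] theorem lt_eval : (lt e f).eval s = 0 ↔ ¬ e.eval s < f.eval s := by
  change (if e.eval s < f.eval s then 1 else 0) = 0 ↔ _
  grind

@[simp] theorem and_eval : (e.and f).eval s = 0 ↔ ¬ (e.eval s ≠ 0 ∧ f.eval s ≠ 0) := by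
  change (if (if e.eval s = 0 then 1 else 0) < (if 0 < f.eval s then 1 else 0)
    then 1 else 0) = 0 ↔ _
  grind

@[simp] theorem or_eval : (e.or f).eval s = 0 ↔ e.eval s = 0 ∧ f.eval s = 0 := by
  change (if 0 < (if 0 < f.eval s then 1 else 0) + 1 - (if e.eval s = 0 then 1 else 0)
    then 1 else 0) = 0 ↔ _
  grind

@[simp] theorem not_eval : e.not.eval s = 0 ↔ e.eval s ≠ 0 := by
  change (if e.eval s = 0 then 1 else 0) = 0 ↔ _
  grind

theorem add_eval (h : e.eval s + f.eval s ≤ s.reg 1) :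
    (e.add f).eval s = e.eval s + f.eval s := by
  simp only [add, eval]; omega

end Expr

end

section

/-! ### Three-colourings -/

/-- `A` is the adjacency relation of a simple graph whose vertices are the numbers below `n`. -/
structure IsGraph (n : ℕ) (A : ℕ → ℕ → Prop) : Prop where
  symm : ∀ u v, A u v → A v u
  irrefl : ∀ u, ¬ A u u
  lt : ∀ u v, A u v → u < n

/-- The colours that adjacent vertices may have: colour `1` stands for the independent cut, the
colours `0` and `2` for its two sides. -/
def Compatible (a b : ℕ) : Prop := ¬ (a = 1 ∧ b = 1) ∧ ¬ (a = 0 ∧ b = 2) ∧ ¬ (a = 2 ∧ b = 0)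

/-- Colourings that describe an independent set together with a division of the remaining vertices
into two parts without edges between them. -/
structure IsColoring (n : ℕ) (A : ℕ → ℕ → Prop) (f : ℕ → ℕ) : Prop where
  lt : ∀ u, u < n → f u < 3
  compatible : ∀ u v, A u v → Compatible (f u) (f v)

/-- The existence of an independent cut, in terms of colourings: both sides occur. -/
def CutColorable (n : ℕ) (A : ℕ → ℕ → Prop) : Prop :=
  ∃ f, IsColoring n A f ∧ ∃ u < n, ∃ v < n, f u = 0 ∧ f v = 2

/-- The adjacency relation of `G` on natural numbers. -/
def natAdj {n : ℕ} (G : SimpleGraph (Fin n)) (u v : ℕ) : Prop :=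
  ∃ i j : Fin n, u = i ∧ v = j ∧ G.Adj i j

theorem natAdj_isGraph {n : ℕ} (G : SimpleGraph (Fin n)) : IsGraph n (natAdj G) where
  symm := by rintro u v ⟨i, j, hi, hj, h⟩; exact ⟨j, i, hj, hi, h.symm⟩
  irrefl := by
    rintro u ⟨i, j, hi, hj, h⟩
    exact h.ne (Fin.ext (hi.symm.trans hj))
  lt := by rintro u v ⟨i, j, hi, hj, h⟩; rw [hi]; exact i.2

theorem natAdj_coe {n : ℕ} (G : SimpleGraph (Fin n)) (i j : Fin n) :
    natAdj G i j ↔ G.Adj i j := by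
  constructor
  · rintro ⟨i', j', hi, hj, h⟩
    rwa [Fin.ext hi, Fin.ext hj]
  · exact fun h => ⟨i, j, rfl, rfl, h⟩

theorem hasIndependentCut_iff {n : ℕ} (G : SimpleGraph (Fin n)) :
    HasIndependentCut G ↔ CutColorable n (natAdj G) := by
  classical
  constructor
  · rintro ⟨S, hS, hG⟩
    unfold SimpleGraph.Preconnected at hG
    push Not at hG
    obtain ⟨x, y, hxy⟩ := hG
    let g : Fin n → ℕ := fun z =>
      if h : z ∈ S then 1 else if (G.induce Sᶜ).Reachable x ⟨z, h⟩ then 0 else 2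
    refine ⟨fun u => if h : u < n then g ⟨u, h⟩ else 0, ⟨?_, ?_⟩, x, x.1.2, y, y.1.2, ?_, ?_⟩
    · intro u hu
      simp only [hu, dif_pos, g]
      split_ifs <;> omega
    · rintro _ _ ⟨i, j, rfl, rfl, hij⟩
      simp only [i.2, j.2, dif_pos, Fin.eta, g]
      by_cases hi : i ∈ S <;> by_cases hj : j ∈ S
      · exact absurd hij (hS hi hj hij.ne)
      · simp only [hi, hj, dif_pos, Compatible]; split_ifs <;> simp_all
      · simp only [hi, hj, dif_pos, Compatible]; split_ifs <;> simp_all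
      · have hadj : (G.induce Sᶜ).Adj ⟨i, hi⟩ ⟨j, hj⟩ := hij
        have h1 : (G.induce Sᶜ).Reachable x ⟨i, hi⟩ ↔ (G.induce Sᶜ).Reachable x ⟨j, hj⟩ :=
          ⟨fun h => h.trans hadj.reachable, fun h => h.trans hadj.symm.reachable⟩
        simp only [hi, hj, h1, Compatible]
        split_ifs <;> simp_all
    · have : x.1 ∉ S := x.2
      simp [g, this]
    · have : y.1 ∉ S := y.2
      simp [g, this, hxy]
  · rintro ⟨f, hf, u, hu, v, hv, hfu, hfv⟩
    refine ⟨{i | f i = 1}, ?_, fun hpre => ?_⟩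
    · intro i hi j hj _ hij
      exact (hf.compatible i j ((natAdj_coe G i j).2 hij)).1 ⟨hi, hj⟩
    · have huS : (⟨u, hu⟩ : Fin n) ∈ ({i : Fin n | f i = 1} : Set (Fin n))ᶜ := by simp [hfu]
      have hvS : (⟨v, hv⟩ : Fin n) ∈ ({i : Fin n | f i = 1} : Set (Fin n))ᶜ := by simp [hfv]
      obtain ⟨p⟩ := hpre ⟨⟨u, hu⟩, huS⟩ ⟨⟨v, hv⟩, hvS⟩
      have key : ∀ (a b : ({i : Fin n | f i = 1}ᶜ : Set (Fin n))),
          (G.induce {i : Fin n | f i = 1}ᶜ).Walk a b → f a.1 = 0 → f b.1 = 0 := by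
        intro a b p
        induction p with
        | nil => exact id
        | @cons a b c hab _ ih =>
          intro ha
          have h1 := hf.compatible a.1 b.1 ((natAdj_coe G _ _).2 hab)
          have h2 : f b.1 ≠ 1 := b.2
          have h3 := hf.lt b.1 b.1.2
          apply ih
          unfold Compatible at h1
          omega
      have := key _ _ p hfu
      simp only at this
      omega

/-- A vertex in no triangle has an independent neighbourhood, which separates it from any
non-neighbour. -/
theorem cutColorable_of_no_triangle {n : ℕ} {A : ℕ → ℕ → Prop} (hA : IsGraph n A) {w z : ℕ}
    (hw : w < n) (hz : z < n) (hwz : w ≠ z) (hn : ¬ A w z)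
    (ht : ¬ ∃ p q, A w p ∧ A w q ∧ A p q) : CutColorable n A := by
  classical
  refine ⟨fun x => if x = w then 0 else if A w x then 1 else 2, ⟨?_, ?_⟩, w, hw, z, hz, ?_, ?_⟩
  · intro u _
    split_ifs <;> omega
  · intro u v huv
    have h1 := hA.symm _ _ huv
    have h2 := hA.irrefl
    push Not at ht
    have h3 := ht u v
    dsimp only [Compatible]
    split_ifs <;> grind
  · simp
  · simp [hwz.symm, hn]

/-! ### Path consistency -/

/-- `R a b u v` says that the colours `a` at `u` and `b` at `v` have not been excluded.  If an
extension to any third vertex is always possible, and if every vertex has lost a colour, then the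
remaining pairs extend to colourings: the colours at a new vertex allowed by the vertices coloured
so far are pairwise intersecting subsets of a set of two colours, hence have a common element. -/
theorem exists_coloring {n : ℕ} {A : ℕ → ℕ → Prop} (hA : IsGraph n A)
    {R : ℕ → ℕ → ℕ → ℕ → Prop}
    (hcons : ∀ a < 3, ∀ b < 3, ∀ u < n, ∀ v < n, ∀ w < n, R a b u v →
      ∃ c < 3, R a c u w ∧ R b c v w)
    (hdiag : ∀ a < 3, ∀ b < 3, ∀ u < n, R a b u u → a = b)
    (hcomp : ∀ a < 3, ∀ b < 3, ∀ u < n, ∀ v < n, R a b u v → A u v → Compatible a b)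
    (htwo : ∀ w < n, ∃ e < 3, ¬ R e e w w)
    {a₀ b₀ u₀ v₀ : ℕ} (ha : a₀ < 3) (hb : b₀ < 3) (hu : u₀ < n) (hv : v₀ < n) (hne : u₀ ≠ v₀)
    (h : R a₀ b₀ u₀ v₀) :
    ∃ f, IsColoring n A f ∧ f u₀ = a₀ ∧ f v₀ = b₀ := by
  have hsymm : ∀ a < 3, ∀ b < 3, ∀ u < n, ∀ v < n, R a b u v → R b a v u := by
    intro a ha b hb u hu v hv h
    obtain ⟨c, hc, h1, h2⟩ := hcons a ha b hb u hu v hv u hu h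
    rwa [hdiag a ha c hc u hu h1]
  have hself : ∀ a < 3, ∀ b < 3, ∀ u < n, ∀ v < n, R a b u v → R a a u u := by
    intro a ha b hb u hu v hv h
    obtain ⟨c, hc, h1, h2⟩ := hcons a ha b hb u hu v hv u hu h
    have := hdiag a ha c hc u hu h1
    rwa [← this] at h1
  have key : ∀ k ≤ n, ∃ f : ℕ → ℕ, f u₀ = a₀ ∧ f v₀ = b₀ ∧
      ∀ x < n, ∀ y < n, (x < k ∨ x = u₀ ∨ x = v₀) → (y < k ∨ y = u₀ ∨ y = v₀) →
        f x < 3 ∧ R (f x) (f y) x y := by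
    intro k
    induction k with
    | zero =>
      intro _
      have h1 := hsymm _ ha _ hb _ hu _ hv h
      have h2 := hself _ ha _ hb _ hu _ hv h
      have h3 := hself _ hb _ ha _ hv _ hu h1
      exact ⟨fun x => if x = u₀ then a₀ else b₀, by simp, by simp [hne.symm], by grind⟩
    | succ k ih =>
      intro hk
      obtain ⟨f, hfu, hfv, hf⟩ := ih (by omega)
      by_cases hku : k = u₀ ∨ k = v₀
      · exact ⟨f, hfu, hfv, fun x hx y hy h1 h2 => hf x hx y hy (by omega) (by omega)⟩
      push Not at hku
      have hpair : ∀ x < n, ∀ y < n, (x < k ∨ x = u₀ ∨ x = v₀) → (y < k ∨ y = u₀ ∨ y = v₀) →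
          ∃ c < 3, R c c k k ∧ R (f x) c x k ∧ R (f y) c y k := by
        intro x hx y hy h1 h2
        obtain ⟨h3, h4⟩ := hf x hx y hy h1 h2
        have h5 := (hf y hy x hx h2 h1).1
        obtain ⟨c, hc, h6, h7⟩ := hcons _ h3 _ h5 x hx y hy k hk h4
        exact ⟨c, hc, hself _ hc _ h3 _ hk _ hx (hsymm _ h3 _ hc _ hx _ hk h6), h6, h7⟩
      have hc : ∃ c < 3, ∀ x < n, (x < k ∨ x = u₀ ∨ x = v₀) → R (f x) c x k := by
        by_contra hcon
        push Not at hcon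
        obtain ⟨e, he, hek⟩ := htwo k hk
        obtain ⟨p, q, hp, hq, hpq⟩ : ∃ p q, p < 3 ∧ q < 3 ∧
            ∀ c < 3, R c c k k → c = p ∨ c = q := by
          have : ∀ c, R c c k k → c ≠ e := by rintro c hc rfl; exact hek hc
          refine ⟨(e + 1) % 3, (e + 2) % 3, by omega, by omega, fun c hc h => ?_⟩
          have := this c h
          omega
        obtain ⟨x, hx, hxk, hxp⟩ := hcon p hp
        obtain ⟨y, hy, hyk, hyq⟩ := hcon q hq
        obtain ⟨c, hc3, h1, h2, h3⟩ := hpair x hx y hy hxk hyk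
        rcases hpq c hc3 h1 with rfl | rfl
        · exact hxp h2
        · exact hyq h3
      obtain ⟨c, hc3, hc⟩ := hc
      have hkk : R c c k k := by
        have h3 := (hf u₀ hu u₀ hu (by simp) (by simp)).1
        exact hself _ hc3 _ h3 _ hk _ hu (hsymm _ h3 _ hc3 _ hu _ hk (hc u₀ hu (by simp)))
      refine ⟨fun x => if x = k then c else f x, by simp [hku.1.symm, hfu],
        by simp [hku.2.symm, hfv], ?_⟩
      intro x hx y hy h1 h2
      by_cases hxk : x = k <;> by_cases hyk : y = k
      · subst hxk; subst hyk; simpa using ⟨hc3, hkk⟩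
      · subst hxk
        have h4 : y < x ∨ y = u₀ ∨ y = v₀ := by omega
        have h3 := (hf y hy y hy h4 h4).1
        simpa [hyk] using ⟨hc3, hsymm _ h3 _ hc3 _ hy _ hx (hc y hy h4)⟩
      · subst hyk
        have h4 : x < y ∨ x = u₀ ∨ x = v₀ := by omega
        have h3 := (hf x hx x hx h4 h4).1
        simpa [hxk] using ⟨h3, hc x hx h4⟩
      · simpa [hxk, hyk] using hf x hx y hy (by omega) (by omega)
  obtain ⟨f, hfu, hfv, hf⟩ := key n le_rfl
  refine ⟨f, ⟨fun u hu => (hf u hu u hu (.inl hu) (.inl hu)).1, fun u v huv => ?_⟩, hfu, hfv⟩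
  have h1 := hA.lt _ _ huv
  have h2 := hA.lt _ _ (hA.symm _ _ huv)
  have h3 := hf u h1 v h2 (.inl h1) (.inl h2)
  exact hcomp _ h3.1 _ (hf v h2 u h1 (.inl h2) (.inl h1)).1 _ h1 _ h2 h3.2 huv

/-! ### Windmills -/

/-- Disjoint windmills, that is, sets of triangles with a common centre and otherwise disjoint.
The value `ct v` is `0` if `v` belongs to no windmill and otherwise one more than the centre of the
windmill of `v`; the third vertex of the triangle of a vertex `v` that is not a centre is `mt v`. -/
structure IsWindmills (n : ℕ) (A : ℕ → ℕ → Prop) (ct mt : ℕ → ℕ) : Prop where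
  center : ∀ v < n, ∀ c, ct v = c + 1 → c < n ∧ ct c = c + 1
  leaf : ∀ v < n, ∀ c, ct v = c + 1 → v ≠ c → mt v < n ∧ mt v ≠ c ∧ ct (mt v) = c + 1 ∧
    mt (mt v) = v ∧ A v (mt v) ∧ A v c
  nonempty : ∀ c < n, ct c = c + 1 → ∃ v < n, v ≠ c ∧ ct v = c + 1

/-- The number of vertices in windmills. -/
def covered (n : ℕ) (ct : ℕ → ℕ) : ℕ := ((Finset.range n).filter fun v => ct v ≠ 0).card

theorem covered_le (n : ℕ) (ct : ℕ → ℕ) : covered n ct ≤ n :=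
  (Finset.card_filter_le _ _).trans (by simp)

open Function (update)

section Extension

variable {n : ℕ} {A : ℕ → ℕ → Prop} {ct mt : ℕ → ℕ} {w u v : ℕ}

/-- A new triangle is added to the windmill of the centre `v`, or forms a new one. -/
theorem IsWindmills.add (hA : IsGraph n A) (h : IsWindmills n A ct mt)
    (hwu : A w u) (hwv : A w v) (huv : A u v) (hw : ct w = 0) (hu : ct u = 0)
    (hv : ct v = 0 ∨ ct v = v + 1) :
    IsWindmills n A (update (update (update ct v (v + 1)) w (v + 1)) u (v + 1))
      (update (update mt w u) u w) := by
  have h1 : w ≠ u := by rintro rfl; exact hA.irrefl _ hwu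
  have h2 : w ≠ v := by rintro rfl; exact hA.irrefl _ hwv
  have h3 : u ≠ v := by rintro rfl; exact hA.irrefl _ huv
  have hwn := hA.lt _ _ hwu
  have hun := hA.lt _ _ huv
  have hvn := hA.lt _ _ (hA.symm _ _ huv)
  have huw := hA.symm _ _ hwu
  obtain ⟨hc, hl, hn⟩ := h
  refine ⟨?_, ?_, ?_⟩
  · intro x hx c
    have := hc x hx c
    simp only [Function.update_apply]
    split_ifs <;> grind
  · intro x hx c hxc hne
    by_cases hxu : x = u
    · subst hxu
      obtain rfl : v = c := by simpa using hxc
      simp [h1, h2, hwn, huw, huv]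
    by_cases hxw : x = w
    · subst hxw
      obtain rfl : v = c := by simpa [h1] using hxc
      simp [h1, h3, hun, hwu, hwv]
    by_cases hxv : x = v
    · subst hxv
      have : x = c := by simpa [h2.symm, h3.symm] using hxc
      exact absurd this hne
    simp only [Function.update_apply, if_neg hxu, if_neg hxw, if_neg hxv] at hxc ⊢
    obtain ⟨h4, h5, h6, h7, h8⟩ := hl x hx c hxc hne
    have h9 : mt x ≠ u := by rintro h; rw [h] at h6; omega
    have h10 : mt x ≠ w := by rintro h; rw [h] at h6; omega
    have h11 : mt x ≠ v := by rintro h; rw [h] at h6; omega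
    simp [h9, h10, h11, h4, h5, h6, h7, h8]
  · intro c hcn
    by_cases hcv : c = v
    · subst hcv
      intro _
      exact ⟨u, hun, h3, by simp⟩
    simp only [Function.update_apply]
    intro h
    have h0 : ct c = c + 1 := by split_ifs at h <;> omega
    obtain ⟨y, hy, hyc, hyn⟩ := hn c hcn h0
    refine ⟨y, hy, hyc, ?_⟩
    split_ifs <;> grind

/-- A triangle is removed from a windmill with several triangles. -/
theorem IsWindmills.remove (h : IsWindmills n A ct mt)
    {x : ℕ} (hvn : v < n) (hx : ct v = x + 1) (hxv : v ≠ x)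
    {z : ℕ} (hz : z < n) (hzx : ct z = x + 1) (hzx' : z ≠ x) (hzv : z ≠ v) (hzy : z ≠ mt v) :
    IsWindmills n A (update (update ct (mt v) 0) v 0) mt := by
  obtain ⟨hc, hl, hn⟩ := h
  obtain ⟨h4, h5, h6, h7, h8⟩ := hl v hvn x hx hxv
  obtain ⟨hxn, hxx⟩ := hc v hvn x hx
  refine ⟨?_, ?_, ?_⟩
  · intro p hp c
    have := hc p hp c
    simp only [Function.update_apply]
    split_ifs <;> grind
  · intro p hp c
    simp only [Function.update_apply]
    intro hpc hne
    obtain ⟨hpv, hpm, hpc⟩ : p ≠ v ∧ p ≠ mt v ∧ ct p = c + 1 := by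
      split_ifs at hpc; exact ⟨by assumption, by assumption, hpc⟩
    obtain ⟨k1, k2, k3, k4, k5⟩ := hl p hp c hpc hne
    have h9 : mt p ≠ v := by rintro h; rw [h] at k4; exact hpm k4.symm
    have h10 : mt p ≠ mt v := by intro h; rw [h, h7] at k4; exact hpv k4.symm
    simp [h9, h10, k1, k2, k3, k4, k5]
  · intro c hcn
    simp only [Function.update_apply]
    intro h
    have h0 : ct c = c + 1 := by split_ifs at h; exact h
    by_cases hcx : c = x
    · subst hcx
      exact ⟨z, hz, hzx', by simp [hzv, hzy, hzx]⟩
    obtain ⟨y, hy, hyc, hyn⟩ := hn c hcn h0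
    refine ⟨y, hy, hyc, ?_⟩
    split_ifs <;> grind

/-- In a windmill that consists of one triangle, any vertex can be the centre. -/
theorem IsWindmills.recenter (hA : IsGraph n A) (h : IsWindmills n A ct mt)
    {x : ℕ} (hvn : v < n) (hx : ct v = x + 1) (hxv : v ≠ x)
    (hz : ∀ z < n, ct z = x + 1 → z = x ∨ z = v ∨ z = mt v) :
    IsWindmills n A (update (update (update ct x (v + 1)) (mt v) (v + 1)) v (v + 1))
      (update (update mt x (mt v)) (mt v) x) := by
  obtain ⟨hc, hl, hn⟩ := h
  obtain ⟨h4, h5, h6, h7, h8, h9⟩ := hl v hvn x hx hxv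
  obtain ⟨k4, k5, k6, k7, k8, k9⟩ := hl _ h4 x h6 h5
  obtain ⟨hxn, hxx⟩ := hc v hvn x hx
  have hmv : mt v ≠ v := by intro h; rw [h] at h8; exact hA.irrefl _ h8
  have hvx' := hA.symm _ _ h9
  have hmx' := hA.symm _ _ k9
  have hmv' := hA.symm _ _ h8
  refine ⟨?_, ?_, ?_⟩
  · intro p hp c
    have := hc p hp c
    simp only [Function.update_apply]
    split_ifs <;> grind
  · intro p hp c hpc hne
    by_cases hpv : p = v
    · subst hpv
      have : p = c := by simpa using hpc
      exact absurd this hne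
    by_cases hpm : p = mt v
    · subst hpm
      obtain rfl : v = c := by simpa [hpv] using hpc
      simp [hxv.symm, h5.symm, hxn, hmv', k9]
    by_cases hpx : p = x
    · subst hpx
      obtain rfl : v = c := by simpa [hpv, hpm] using hpc
      simp [hpm, hmv, h4, hmx', hvx']
    simp only [Function.update_apply, if_neg hpv, if_neg hpm, if_neg hpx] at hpc ⊢
    obtain ⟨m4, m5, m6, m7, m8⟩ := hl p hp c hpc hne
    have hcx : c ≠ x := by
      rintro rfl
      have := hz p hp hpc
      omega
    have e1 : mt p ≠ v := by rintro h; rw [h] at m6; omega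
    have e2 : mt p ≠ x := by rintro h; rw [h] at m6; omega
    have e3 : mt p ≠ mt v := by rintro h; rw [h] at m6; omega
    simp [e1, e2, e3, m4, m5, m6, m7, m8]
  · intro c hcn
    by_cases hcv : c = v
    · subst hcv
      intro _
      exact ⟨mt c, h4, hmv, by simp [hmv]⟩
    simp only [Function.update_apply]
    intro h
    have h0 : ct c = c + 1 ∧ c ≠ x := by split_ifs at h <;> grind
    obtain ⟨y, hy, hyc, hyn⟩ := hn c hcn h0.1
    refine ⟨y, hy, hyc, ?_⟩
    have : ct y ≠ x + 1 := by omega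
    split_ifs <;> grind

theorem covered_le_update {c : ℕ} (hc : c ≠ 0) (x : ℕ) :
    covered n ct ≤ covered n (update ct x c) := by
  apply Finset.card_le_card
  intro y
  simp only [Finset.mem_filter, Function.update_apply]
  rintro ⟨h1, h2⟩
  refine ⟨h1, ?_⟩
  split_ifs <;> assumption

theorem covered_lt_update {c x : ℕ} (hc : c ≠ 0) (hx : x < n) (h : ct x = 0) :
    covered n ct + 1 ≤ covered n (update ct x c) := by
  apply Finset.card_lt_card
  rw [Finset.ssubset_iff_of_subset]
  · exact ⟨x, by simp [hx, hc], by simp [h]⟩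
  · intro y
    simp only [Finset.mem_filter, Function.update_apply]
    rintro ⟨h1, h2⟩
    refine ⟨h1, ?_⟩
    split_ifs <;> assumption

theorem covered_le_update_zero (x : ℕ) : covered n ct ≤ covered n (update ct x 0) + 1 := by
  unfold covered
  refine le_trans (Finset.card_le_card ?_) (Finset.card_insert_le x _)
  intro y
  simp only [Finset.mem_filter, Function.update_apply, Finset.mem_insert]
  rintro ⟨h1, h2⟩
  by_cases h : y = x
  · exact .inl h
  · exact .inr ⟨h1, by simpa [h]⟩

theorem covered_add (hA : IsGraph n A) (hwu : A w u) (hwv : A w v) (huv : A u v)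
    (hw : ct w = 0) (hu : ct u = 0) :
    covered n (update ct v (v + 1)) + 2 ≤
      covered n (update (update (update ct v (v + 1)) w (v + 1)) u (v + 1)) := by
  have h1 : u ≠ w := by rintro rfl; exact hA.irrefl _ hwu
  have h2 : w ≠ v := by rintro rfl; exact hA.irrefl _ hwv
  have h3 : u ≠ v := by rintro rfl; exact hA.irrefl _ huv
  have k1 := covered_lt_update (n := n) (ct := update ct v (v + 1)) (c := v + 1) (x := w)
    (by omega) (hA.lt _ _ hwu) (by simp [h2, hw])
  have k2 := covered_lt_update (n := n) (ct := update (update ct v (v + 1)) w (v + 1)) (c := v + 1)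
    (x := u) (by omega) (hA.lt _ _ huv) (by simp [h1, h3, hu])
  omega

end Extension

/-- The vertices that carry a bit: one of the two vertices besides the centre in each triangle. -/
def IsRep (ct mt : ℕ → ℕ) (i : ℕ) : Prop := ct i ≠ 0 ∧ ct i ≠ i + 1 ∧ i < mt i

instance (ct mt : ℕ → ℕ) : DecidablePred (IsRep ct mt) :=
  fun i => inferInstanceAs (Decidable (ct i ≠ 0 ∧ ct i ≠ i + 1 ∧ i < mt i))

/-- The number of representatives below `k`. -/
def repCount (ct mt : ℕ → ℕ) (k : ℕ) : ℕ := ((Finset.range k).filter (IsRep ct mt)).card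

/-- A windmill with `j` triangles has `2 j + 1` vertices, and its centre has degree at
least `2 j`. -/
theorem IsWindmills.repCount_le {n : ℕ} {A : ℕ → ℕ → Prop} {ct mt : ℕ → ℕ} (hA : IsGraph n A)
    (h : IsWindmills n A ct mt) {Δ : ℕ}
    (hΔ : ∀ c < n, ∀ s : Finset ℕ, (∀ x ∈ s, A c x) → s.card ≤ Δ) :
    repCount ct mt n * (1 + 2 * (Δ / 2)) ≤ Δ / 2 * n := by
  classical
  let P := (Finset.range n).filter (IsRep ct mt)
  let C := (Finset.range n).filter fun c => ct c = c + 1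
  let d := Δ / 2
  have hleaf : ∀ i ∈ P, ∃ c, ct i = c + 1 ∧ i ≠ c ∧ c < n ∧ ct c = c + 1 ∧ i < n ∧ i < mt i := by
    intro i hi
    obtain ⟨hin, h1, h2, h3⟩ := by simpa [P, IsRep] using hi
    obtain ⟨c, hc⟩ := Nat.exists_eq_succ_of_ne_zero h1
    have := h.center i hin c hc
    exact ⟨c, hc, by omega, this.1, this.2, hin, h3⟩
  have hmt : ∀ i ∈ P, mt (mt i) = i := by
    intro i hi
    obtain ⟨c, h1, h2, h3, h4, h5, h6⟩ := hleaf i hi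
    exact (h.leaf i h5 c h1 h2).2.2.2.1
  have hinj : Set.InjOn mt P := by
    intro i hi j hj hij
    rw [← hmt i hi, ← hmt j hj, hij]
  have hfib : ∀ c ∈ C, (P.filter fun i => ct i = c + 1).card ≤ d := by
    intro c hc
    have hcn : c < n := by simpa using (Finset.mem_filter.1 hc).1
    let Pc := P.filter fun i => ct i = c + 1
    have hdisj : Disjoint Pc (Pc.image mt) := by
      rw [Finset.disjoint_left]
      intro i hi hi'
      obtain ⟨j, hj, rfl⟩ := Finset.mem_image.1 hi'
      have hi := (Finset.mem_filter.1 hi).1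
      have hj := (Finset.mem_filter.1 hj).1
      obtain ⟨_, _, _, _, _, _, h6⟩ := hleaf _ hi
      obtain ⟨_, _, _, _, _, _, h7⟩ := hleaf _ hj
      rw [hmt j hj] at h6
      omega
    have hcard : (Pc.image mt).card = Pc.card := by
      apply Finset.card_image_of_injOn
      exact hinj.mono fun i hi => (Finset.mem_filter.1 hi).1
    have := hΔ c hcn (Pc ∪ Pc.image mt) (by
      have hPc : ∀ i ∈ Pc, A c i ∧ A c (mt i) := by
        intro i hi
        obtain ⟨hi, hic⟩ := Finset.mem_filter.1 hi
        obtain ⟨c', h1, h2, h3, h4, h5, h6⟩ := hleaf i hi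
        obtain rfl : c' = c := by omega
        obtain ⟨k1, k2, k3, k4, k5, k6⟩ := h.leaf i h5 c' h1 h2
        exact ⟨hA.symm _ _ k6, hA.symm _ _ (h.leaf _ k1 c' k3 k2).2.2.2.2.2⟩
      intro x hx
      rcases Finset.mem_union.1 hx with hx | hx
      · exact (hPc x hx).1
      · obtain ⟨i, hi, rfl⟩ := Finset.mem_image.1 hx
        exact (hPc i hi).2)
    rw [Finset.card_union_of_disjoint hdisj, hcard] at this
    change Pc.card ≤ Δ / 2
    omega
  have hPC : P.card ≤ d * C.card := by
    rw [mul_comm]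
    have hmap : ∀ i ∈ P, ct i - 1 ∈ C := by
      intro i hi
      obtain ⟨c, h1, h2, h3, h4, h5, h6⟩ := hleaf i hi
      simp [C, h1, h3, h4]
    rw [Finset.card_eq_sum_card_fiberwise hmap, ← smul_eq_mul]
    apply Finset.sum_le_card_nsmul
    intro c hc
    refine le_trans (Finset.card_le_card ?_) (hfib c hc)
    intro i hi
    obtain ⟨hi, hic⟩ := Finset.mem_filter.1 hi
    obtain ⟨c', h1, -⟩ := hleaf i hi
    exact Finset.mem_filter.2 ⟨hi, by omega⟩
  have hdisj : Disjoint P (P.image mt) := by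
    rw [Finset.disjoint_left]
    intro i hi hi'
    obtain ⟨j, hj, rfl⟩ := Finset.mem_image.1 hi'
    obtain ⟨_, _, _, _, _, _, h6⟩ := hleaf _ hi
    obtain ⟨_, _, _, _, _, _, h7⟩ := hleaf _ hj
    rw [hmt j hj] at h6
    omega
  have hdisj' : Disjoint (P ∪ P.image mt) C := by
    rw [Finset.disjoint_left]
    intro i hi hi'
    have hi' : ct i = i + 1 := (Finset.mem_filter.1 hi').2
    rcases Finset.mem_union.1 hi with hi | hi
    · obtain ⟨c, h1, h2, -⟩ := hleaf i hi
      omega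
    · obtain ⟨j, hj, rfl⟩ := Finset.mem_image.1 hi
      obtain ⟨c, h1, h2, h3, h4, h5, h6⟩ := hleaf j hj
      obtain ⟨k1, k2, k3, k4, k5, k6⟩ := h.leaf j h5 c h1 h2
      omega
  have hn : ((P ∪ P.image mt) ∪ C).card ≤ n := by
    refine (Finset.card_le_card ?_).trans (Finset.card_range n).le
    intro x hx
    rw [Finset.mem_range]
    simp only [Finset.mem_union] at hx
    rcases hx with (hx | hx) | hx
    · exact Finset.mem_range.1 (Finset.mem_filter.1 hx).1
    · obtain ⟨j, hj, rfl⟩ := Finset.mem_image.1 hx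
      obtain ⟨c, h1, h2, h3, h4, h5, h6⟩ := hleaf j hj
      exact (h.leaf j h5 c h1 h2).1
    · exact Finset.mem_range.1 (Finset.mem_filter.1 hx).1
  rw [Finset.card_union_of_disjoint hdisj', Finset.card_union_of_disjoint hdisj,
    Finset.card_image_of_injOn hinj] at hn
  change P.card * (1 + 2 * d) ≤ d * n
  have := Nat.mul_le_mul_left d hn
  nlinarith

/-! ### Vertices with two colours -/

/-- No triangle has two vertices outside the windmills: if `w` is outside, then `u` is not. -/
def IsMaximal (A : ℕ → ℕ → Prop) (ct : ℕ → ℕ) : Prop :=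
  ∀ w u v, A w u → A w v → A u v → ct w = 0 → ct u ≠ 0

/-- The colours that a choice of bits forbids: both vertices of a triangle besides the centre avoid
colour `2` if the bit is `0`, and colour `0` otherwise. -/
def Forbidden (ct mt bit : ℕ → ℕ) (u a : ℕ) : Prop :=
  ct u ≠ 0 ∧ ct u ≠ u + 1 ∧
    (((bit u ≠ 0 ∨ bit (mt u) ≠ 0) ∧ a = 0) ∨ (¬ (bit u ≠ 0 ∨ bit (mt u) ≠ 0) ∧ a = 2))

/-- The pairs of colours at `u` and `v` that are not immediately excluded. -/
def Allowed (A : ℕ → ℕ → Prop) (ct mt bit : ℕ → ℕ) (a b u v : ℕ) : Prop :=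
  (u = v → a = b) ∧ (A u v → Compatible a b) ∧ ¬ Forbidden ct mt bit u a

section TwoColours

variable {n : ℕ} {A : ℕ → ℕ → Prop} {R : ℕ → ℕ → ℕ → ℕ → Prop}

/-- If the adjacent vertices `u` and `v` avoid the same colour `e ≠ 1`, then so does each common
neighbour `x`: its colour `e` would force `1` on both. -/
theorem avoids_same (hA : IsGraph n A)
    (hcons : ∀ a < 3, ∀ b < 3, ∀ u < n, ∀ v < n, ∀ w < n, R a b u v →
      ∃ c < 3, R a c u w ∧ R b c v w)
    (hcomp : ∀ a < 3, ∀ b < 3, ∀ u < n, ∀ v < n, R a b u v → A u v → Compatible a b)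
    (hself : ∀ a < 3, ∀ b < 3, ∀ u < n, ∀ v < n, R a b u v → R b b v v)
    {x u v e : ℕ} (hxu : A x u) (hxv : A x v) (huv : A u v) (he : e = 0 ∨ e = 2)
    (hu : ¬ R e e u u) (hv : ¬ R e e v v) : ¬ R e e x x := by
  intro hx
  have hxn := hA.lt _ _ hxu
  have hun := hA.lt _ _ huv
  have hvn := hA.lt _ _ (hA.symm _ _ huv)
  have he3 : e < 3 := by omega
  obtain ⟨c, hc, h1, -⟩ := hcons e he3 e he3 x hxn x hxn u hun hx
  have h2 := hcomp _ he3 _ hc _ hxn _ hun h1 hxu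
  have h3 : c ≠ e := by rintro rfl; exact hu (hself _ hc _ hc _ hxn _ hun h1)
  obtain rfl : c = 1 := by unfold Compatible at h2; omega
  obtain ⟨c, hc', h4, h5⟩ := hcons e he3 1 hc x hxn u hun v hvn h1
  have h6 := hcomp _ he3 _ hc' _ hxn _ hvn h4 hxv
  have h7 : c ≠ e := by rintro rfl; exact hv (hself _ hc' _ hc' _ hxn _ hvn h4)
  obtain rfl : c = 1 := by unfold Compatible at h6; omega
  exact (hcomp _ hc _ hc _ hun _ hvn h5 huv).1 ⟨rfl, rfl⟩

/-- If the adjacent vertices `u` and `v` avoid `2` and `0`, respectively, then each common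
neighbour avoids `1`, which would force `0` on `u` and `2` on `v`. -/
theorem avoids_one (hA : IsGraph n A)
    (hcons : ∀ a < 3, ∀ b < 3, ∀ u < n, ∀ v < n, ∀ w < n, R a b u v →
      ∃ c < 3, R a c u w ∧ R b c v w)
    (hcomp : ∀ a < 3, ∀ b < 3, ∀ u < n, ∀ v < n, R a b u v → A u v → Compatible a b)
    (hself : ∀ a < 3, ∀ b < 3, ∀ u < n, ∀ v < n, R a b u v → R b b v v)
    {x u v : ℕ} (hxu : A x u) (hxv : A x v) (huv : A u v)
    (hu : ¬ R 2 2 u u) (hv : ¬ R 0 0 v v) : ¬ R 1 1 x x := by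
  intro hx
  have hxn := hA.lt _ _ hxu
  have hun := hA.lt _ _ huv
  have hvn := hA.lt _ _ (hA.symm _ _ huv)
  obtain ⟨c, hc, h1, -⟩ := hcons 1 (by omega) 1 (by omega) x hxn x hxn u hun hx
  have h2 := hcomp _ (by omega) _ hc _ hxn _ hun h1 hxu
  have h3 : c ≠ 2 := by rintro rfl; exact hu (hself _ (by omega) _ hc _ hxn _ hun h1)
  obtain rfl : c = 0 := by unfold Compatible at h2; omega
  obtain ⟨c, hc', h4, h5⟩ := hcons 1 (by omega) 0 hc x hxn u hun v hvn h1
  have h6 := hcomp _ (by omega) _ hc' _ hxn _ hvn h4 hxv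
  have h7 : c ≠ 0 := by rintro rfl; exact hv (hself _ (by omega) _ hc' _ hxn _ hvn h4)
  obtain rfl : c = 2 := by unfold Compatible at h6; omega
  exact (hcomp _ hc _ hc' _ hun _ hvn h5 huv).2.1 ⟨rfl, rfl⟩

variable {ct mt bit : ℕ → ℕ}

/-- If a path-consistent subrelation of the allowed pairs contains a pair with the colours `0`
and `2`, then there is an independent cut: either a vertex in no triangle yields one, or every
vertex has lost a colour. -/
theorem cutColorable_of_consistent (hA : IsGraph n A) (hW : IsWindmills n A ct mt)
    (hM : IsMaximal A ct)
    (hcons : ∀ a < 3, ∀ b < 3, ∀ u < n, ∀ v < n, ∀ w < n, R a b u v →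
      ∃ c < 3, R a c u w ∧ R b c v w)
    (hR : ∀ a < 3, ∀ b < 3, ∀ u < n, ∀ v < n, R a b u v → Allowed A ct mt bit a b u v)
    {u₀ v₀ : ℕ} (hu₀ : u₀ < n) (hv₀ : v₀ < n) (h : R 0 2 u₀ v₀) : CutColorable n A := by
  by_cases hs : ∃ w < n, ∃ z < n, w ≠ z ∧ ¬ A w z ∧ ¬ ∃ p q, A w p ∧ A w q ∧ A p q
  · obtain ⟨w, hw, z, hz, hwz, hn, ht⟩ := hs
    exact cutColorable_of_no_triangle hA hw hz hwz hn ht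
  push Not at hs
  have hdiag : ∀ a < 3, ∀ b < 3, ∀ u < n, R a b u u → a = b :=
    fun a ha b hb u hu h => (hR a ha b hb u hu u hu h).1 rfl
  have hcomp : ∀ a < 3, ∀ b < 3, ∀ u < n, ∀ v < n, R a b u v → A u v → Compatible a b :=
    fun a ha b hb u hu v hv h => (hR a ha b hb u hu v hv h).2.1
  have hself : ∀ a < 3, ∀ b < 3, ∀ u < n, ∀ v < n, R a b u v → R b b v v := by
    intro a ha b hb u hu v hv h
    obtain ⟨c, hc, h1, h2⟩ := hcons a ha b hb u hu v hv v hv h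
    have := hdiag b hb c hc v hv h2
    rwa [← this] at h2
  have hne : u₀ ≠ v₀ := by
    rintro rfl
    exact absurd (hdiag 0 (by omega) 2 (by omega) u₀ hu₀ h) (by omega)
  have hnadj : ¬ A u₀ v₀ := fun hadj =>
    (hcomp 0 (by omega) 2 (by omega) u₀ hu₀ v₀ hv₀ h hadj).2.1 ⟨rfl, rfl⟩
  -- A vertex in no triangle would be adjacent to all others, so that `u₀` would be in no triangle,
  -- although it has the non-neighbour `v₀`.
  have htri : ∀ w < n, ∃ p q, A w p ∧ A w q ∧ A p q := by
    intro w hw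
    by_contra hcon
    push Not at hcon
    have hall : ∀ z < n, w ≠ z → A w z := by
      intro z hz hwz
      by_contra hn
      obtain ⟨p, q, h1, h2, h3⟩ := hs w hw z hz hwz hn
      exact hcon p q h1 h2 h3
    have hwu : w ≠ u₀ := by rintro rfl; exact hnadj (hall v₀ hv₀ hne)
    obtain ⟨p, q, h1, h2, h3⟩ := hs u₀ hu₀ v₀ hv₀ hne hnadj
    have hp := hA.lt _ _ h3
    have hq := hA.lt _ _ (hA.symm _ _ h3)
    by_cases hwp : w = p
    · subst hwp
      exact hcon u₀ q (hA.symm _ _ h1) h3 h2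
    by_cases hwq : w = q
    · subst hwq
      exact hcon u₀ p (hA.symm _ _ h2) (hA.symm _ _ h3) h1
    exact hcon p q (hall p hp hwp) (hall q hq hwq) h3
  have hleaf : ∀ v < n, ∀ c, ct v = c + 1 → v ≠ c →
      ∃ e, (e = 0 ∨ e = 2) ∧ ¬ R e e v v ∧ ¬ R e e (mt v) (mt v) := by
    intro v hv c hc hvc
    obtain ⟨h1, h2, h3, h4, h5, h6⟩ := hW.leaf v hv c hc hvc
    by_cases hb : bit v ≠ 0 ∨ bit (mt v) ≠ 0
    · refine ⟨0, .inl rfl, fun h => ?_, fun h => ?_⟩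
      · exact (hR 0 (by omega) 0 (by omega) v hv v hv h).2.2
          ⟨by omega, by omega, .inl ⟨hb, rfl⟩⟩
      · exact (hR 0 (by omega) 0 (by omega) _ h1 _ h1 h).2.2
          ⟨by omega, by omega, .inl ⟨by rw [h4]; exact hb.symm, rfl⟩⟩
    · refine ⟨2, .inr rfl, fun h => ?_, fun h => ?_⟩
      · exact (hR 2 (by omega) 2 (by omega) v hv v hv h).2.2
          ⟨by omega, by omega, .inr ⟨hb, rfl⟩⟩
      · exact (hR 2 (by omega) 2 (by omega) _ h1 _ h1 h).2.2
          ⟨by omega, by omega, .inr ⟨by rw [h4]; exact fun h => hb h.symm, rfl⟩⟩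
  have hcov : ∀ v < n, ct v ≠ 0 → ∃ e, (e = 0 ∨ e = 2) ∧ ¬ R e e v v := by
    intro v hv hv0
    obtain ⟨c, hc⟩ := Nat.exists_eq_succ_of_ne_zero hv0
    by_cases hvc : v = c
    · subst hvc
      obtain ⟨y, hy, hyv, hcy⟩ := hW.nonempty v hv hc
      obtain ⟨h1, h2, h3, h4, h5, h6⟩ := hW.leaf y hy v hcy hyv
      have h7 := (hW.leaf _ h1 v h3 h2).2.2.2.2.2
      obtain ⟨e, he, k1, k2⟩ := hleaf y hy v hcy hyv
      exact ⟨e, he, avoids_same hA hcons hcomp hself (hA.symm _ _ h6) (hA.symm _ _ h7) h5 he k1 k2⟩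
    · obtain ⟨e, he, k1, -⟩ := hleaf v hv c hc hvc
      exact ⟨e, he, k1⟩
  have htwo : ∀ w < n, ∃ e < 3, ¬ R e e w w := by
    intro w hw
    by_cases hw0 : ct w = 0
    · obtain ⟨u, v, h1, h2, h3⟩ := htri w hw
      have hu := hM w u v h1 h2 h3 hw0
      have hv := hM w v u h2 h1 (hA.symm _ _ h3) hw0
      obtain ⟨e, he, k1⟩ := hcov u (hA.lt _ _ h3) hu
      obtain ⟨e', he', k2⟩ := hcov v (hA.lt _ _ (hA.symm _ _ h3)) hv
      by_cases hee : e = e'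
      · subst hee
        exact ⟨e, by omega, avoids_same hA hcons hcomp hself h1 h2 h3 he k1 k2⟩
      · refine ⟨1, by omega, ?_⟩
        rcases he with rfl | rfl <;> rcases he' with rfl | rfl
        · exact absurd rfl hee
        · exact avoids_one hA hcons hcomp hself h2 h1 (hA.symm _ _ h3) k2 k1
        · exact avoids_one hA hcons hcomp hself h1 h2 h3 k1 k2
        · exact absurd rfl hee
    · obtain ⟨e, he, k1⟩ := hcov w hw hw0
      exact ⟨e, by omega, k1⟩
  obtain ⟨f, hf, h1, h2⟩ := exists_coloring hA hcons hdiag hcomp htwo (by omega) (by omega)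
    hu₀ hv₀ hne h
  exact ⟨f, hf, u₀, hu₀, v₀, hv₀, h1, h2⟩

/-- For each colouring there is a choice of bits that forbids none of its colours. -/
theorem IsColoring.exists_bits (hA : IsGraph n A) (hW : IsWindmills n A ct mt) {f : ℕ → ℕ}
    (hf : IsColoring n A f) :
    ∃ bit : ℕ → ℕ, (∀ i, bit i ≤ 1) ∧ (∀ i, ¬ (i < n ∧ IsRep ct mt i) → bit i = 0) ∧
      ∀ u < n, ∀ v < n, Allowed A ct mt bit (f u) (f v) u v := by
  classical
  let bit : ℕ → ℕ := fun i => if (i < n ∧ IsRep ct mt i) ∧ (f i = 2 ∨ f (mt i) = 2) then 1 else 0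
  have hbit : ∀ i, bit i ≠ 0 ↔ (i < n ∧ IsRep ct mt i) ∧ (f i = 2 ∨ f (mt i) = 2) := by
    intro i
    simp only [bit]
    split_ifs with h <;> simp [h]
  refine ⟨bit, fun i => by dsimp only [bit]; split_ifs <;> omega, fun i hi => ?_,
    fun u hu v _ => ⟨by rintro rfl; rfl, hf.compatible u v, ?_⟩⟩
  · by_contra h
    exact hi ((hbit i).1 h).1
  rintro ⟨h1, h2, h3⟩
  obtain ⟨c, hc⟩ := Nat.exists_eq_succ_of_ne_zero h1
  obtain ⟨k1, k2, k3, k4, k5, k6⟩ := hW.leaf u hu c hc (by omega)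
  have h4 := hf.compatible _ _ k5
  unfold Compatible at h4
  have h5 := hf.lt u hu
  have h6 := hf.lt _ k1
  have h7 : u ≠ mt u := by
    intro h
    rw [← h] at k5
    exact hA.irrefl _ k5
  have h8 : IsRep ct mt u ∨ IsRep ct mt (mt u) := by
    unfold IsRep
    rw [k3, k4]
    omega
  have h9 : (bit u ≠ 0 ∨ bit (mt u) ≠ 0) ↔ f u = 2 ∨ f (mt u) = 2 := by
    rw [hbit, hbit, k4]
    constructor
    · rintro (h | h)
      · exact h.2
      · exact h.2.symm
    · intro h
      rcases h8 with h8 | h8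
      · exact .inl ⟨⟨hu, h8⟩, h⟩
      · exact .inr ⟨⟨k1, h8⟩, h.symm⟩
  rw [h9] at h3
  omega

end TwoColours

end

section

/-! ### Iteration of local improvements -/

namespace Stmt

/-- The registers `0` and `1` hold `n` and `n * n`, and the arrays satisfy `J`. -/
def Base (n : ℕ) (J : (ℕ → ℕ → ℕ) → Prop) (s : Store) : Prop :=
  s.reg 0 = n ∧ s.reg 1 = n * n ∧ J s.arr

/-- The memory `s'` after one attempt at improvement: if `g` holds in `s`, no array has changed, and
otherwise the potential `Φ` has increased.  In both cases `s'` satisfies the invariant `J`.  This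
relation composes, with the conjunction of the conditions `g`. -/
def Improves (n : ℕ) (J : (ℕ → ℕ → ℕ) → Prop) (Φ : (ℕ → ℕ → ℕ) → ℕ) (g : (ℕ → ℕ → ℕ) → Prop)
    (s s' : Store) : Prop :=
  Base n J s' ∧ (g s.arr ∧ s'.arr = s.arr ∨ ¬ g s.arr ∧ Φ s.arr < Φ s'.arr)

variable {n : ℕ} {J : (ℕ → ℕ → ℕ) → Prop} {Φ : (ℕ → ℕ → ℕ) → ℕ}

theorem Base.setReg {s : Store} (h : Base n J s) {i k : ℕ} (hi : 2 ≤ i) :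
    Base n J (s.setReg i k) := by
  have h0 : 0 ≠ i := by omega
  have h1 : 1 ≠ i := by omega
  simpa [Base, h0, h1] using h

theorem Improves.trans {g g' : (ℕ → ℕ → ℕ) → Prop} {s s' s'' : Store}
    (h : Improves n J Φ g s s') (h' : Improves n J Φ g' s' s'') :
    Improves n J Φ (fun a => g a ∧ g' a) s s'' := by
  obtain ⟨-, h1⟩ := h
  obtain ⟨h2, h3⟩ := h'
  refine ⟨h2, ?_⟩
  rcases h1 with ⟨h1, h4⟩ | ⟨h1, h4⟩
  · rw [h4] at h3
    rcases h3 with ⟨h3, h5⟩ | ⟨h3, h5⟩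
    · exact .inl ⟨⟨h1, h3⟩, h5⟩
    · exact .inr ⟨fun h => h3 h.2, h5⟩
  · refine .inr ⟨fun h => h1 h.1, ?_⟩
    rcases h3 with ⟨h3, h5⟩ | ⟨h3, h5⟩
    · rwa [h5]
    · exact h4.trans h5

theorem Improves.seqs {ι : Type} (l : List ι) (c : ι → Stmt) (g : ι → (ℕ → ℕ → ℕ) → Prop)
    (P : Store → Prop) (hP : ∀ i ∈ l, ∀ s, P s → P ((c i).den s))
    (h : ∀ i ∈ l, ∀ s, Base n J s → P s → Improves n J Φ (g i) s ((c i).den s))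
    {s : Store} (hs : Base n J s) (hPs : P s) :
    Improves n J Φ (fun a => ∀ i ∈ l, g i a) s ((Stmt.seqs (l.map c)).den s) := by
  induction l generalizing s with
  | nil => exact ⟨hs, .inl ⟨by simp, rfl⟩⟩
  | cons i l ih =>
    have h1 := h i (by simp) s hs hPs
    have h2 := ih (fun j hj => hP j (by simp [hj])) (fun j hj => h j (by simp [hj])) h1.1
      (hP i (by simp) s hPs)
    simp only [List.forall_mem_cons]
    exact h1.trans h2

theorem Improves.loop {i : ℕ} (hi : 2 ≤ i) {c : Stmt} {g : ℕ → (ℕ → ℕ → ℕ) → Prop}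
    (P : Store → Prop) (hP : ∀ s, P s → P (c.den s)) (hPi : ∀ s k, P s → P (s.setReg i k))
    (h : ∀ s, Base n J s → P s → s.reg i < n → Improves n J Φ (g (s.reg i)) s (c.den s))
    {s : Store} (hs : Base n J s) (hPs : P s) :
    Improves n J Φ (fun a => ∀ k < n, g k a) s ((Stmt.loop i c).den s) := by
  have := den_loop_induction (i := i) (c := c) (s := s)
    (fun k s' => P s' ∧ Improves n J Φ (fun a => ∀ j < k, g j a) s s')
    ⟨hPi _ _ hPs, hs.setReg hi, .inl ⟨by simp, rfl⟩⟩ (by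
      intro k s' hk hik ⟨hPs', hI⟩
      have h1 := hI.trans (h s' hI.1 hPs' (by rw [hik, ← hs.1]; exact hk))
      refine ⟨hPi _ _ (hP _ hPs'), h1.1.setReg hi, ?_⟩
      have : (fun a => ∀ j < k + 1, g j a) = fun a => (∀ j < k, g j a) ∧ g (s'.reg i) a := by
        ext a
        rw [hik]
        exact Nat.forall_lt_succ_right
      rw [this]
      exact h1.2)
  rw [hs.1] at this
  exact this.2

/-- All triples of vertices are passed in the registers `4`, `5`, `6`. -/
def sweep (c : Stmt) : Stmt := .loop 4 (.loop 5 (.loop 6 c))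

theorem Improves.sweep {c : Stmt} {g : ℕ → ℕ → ℕ → (ℕ → ℕ → ℕ) → Prop}
    (h4 : c.keeps 4 = true) (h5 : c.keeps 5 = true)
    (h : ∀ s, Base n J s → s.reg 4 < n → s.reg 5 < n → s.reg 6 < n →
      Improves n J Φ (g (s.reg 4) (s.reg 5) (s.reg 6)) s (c.den s))
    {s : Store} (hs : Base n J s) :
    Improves n J Φ (fun a => ∀ u < n, ∀ v < n, ∀ w < n, g u v w a) s ((Stmt.sweep c).den s) := by
  refine Improves.loop (g := fun u a => ∀ v < n, ∀ w < n, g u v w a) (by omega) (fun _ => True)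
    (fun _ _ => trivial) (fun _ _ _ => trivial) ?_ hs trivial
  intro s hs _ hs4
  generalize hu : s.reg 4 = u at hs4
  refine Improves.loop (g := fun v a => ∀ w < n, g u v w a) (by omega) (fun s => s.reg 4 = u)
    (fun s h => ?_) (fun s k h => ?_) ?_ hs hu
  · rw [den_reg (by simpa [keeps] using h4), h]
  · simpa using h
  intro s hs hu hs5
  generalize hv : s.reg 5 = v at hs5
  refine Improves.loop (g := fun w a => g u v w a) (by omega)
    (fun s => s.reg 4 = u ∧ s.reg 5 = v) (fun s h => ?_) (fun s k h => ?_) ?_ hs ⟨hu, hv⟩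
  · rwa [den_reg h4, den_reg h5]
  · simpa using h
  rintro s hs ⟨rfl, rfl⟩ hs6
  exact h s hs hs4 hs5 hs6

/-- The effect of `m` rounds of improvement: `g` is satisfied in the end, or the potential has
increased by at least `m`.  So the former holds if `m` exceeds the largest possible potential. -/
def Progress (n : ℕ) (J : (ℕ → ℕ → ℕ) → Prop) (Φ : (ℕ → ℕ → ℕ) → ℕ) (g : (ℕ → ℕ → ℕ) → Prop)
    (m : ℕ) (s s' : Store) : Prop :=
  Base n J s' ∧ (g s.arr → s'.arr = s.arr) ∧ (g s'.arr ∨ Φ s.arr + m ≤ Φ s'.arr)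

variable {g : (ℕ → ℕ → ℕ) → Prop}

theorem Improves.progress {s s' : Store} (h : Improves n J Φ g s s') : Progress n J Φ g 1 s s' := by
  obtain ⟨h1, ⟨h2, h3⟩ | ⟨h2, h3⟩⟩ := h
  · exact ⟨h1, fun _ => h3, .inl (by rwa [h3])⟩
  · exact ⟨h1, fun h => absurd h h2, .inr h3⟩

theorem Progress.trans {m m' : ℕ} {s s' s'' : Store} (h : Progress n J Φ g m s s')
    (h' : Progress n J Φ g m' s' s'') : Progress n J Φ g (m + m') s s'' := by
  obtain ⟨-, h1, h2⟩ := h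
  obtain ⟨h3, h4, h5⟩ := h'
  refine ⟨h3, fun hg => ?_, ?_⟩
  · have := h1 hg
    rw [h4 (by rwa [this]), this]
  · rcases h2 with h2 | h2
    · exact .inl (by rwa [h4 h2])
    · rcases h5 with h5 | h5
      · exact .inl h5
      · exact .inr (by omega)

theorem Progress.loop {i m : ℕ} (hi : 2 ≤ i) {c : Stmt}
    (h : ∀ s, Base n J s → Progress n J Φ g m s (c.den s)) {s : Store} (hs : Base n J s) :
    Progress n J Φ g (n * m) s ((Stmt.loop i c).den s) := by
  have := den_loop_induction (i := i) (c := c) (s := s)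
    (fun k s' => Progress n J Φ g (k * m) s s')
    ⟨hs.setReg hi, fun _ => rfl, .inr (by simp)⟩ (by
      intro k s' hk hik hI
      have h1 := hI.trans (h s' hI.1)
      rw [add_mul, one_mul]
      exact ⟨h1.1.setReg hi, h1.2⟩)
  rwa [hs.1] at this

theorem Progress.replicate {m : ℕ} {c : Stmt}
    (h : ∀ s, Base n J s → Progress n J Φ g m s (c.den s)) (k : ℕ) {s : Store} (hs : Base n J s) :
    Progress n J Φ g (k * m) s ((Stmt.seqs (List.replicate k c)).den s) := by
  induction k generalizing s with
  | zero => exact ⟨hs, fun _ => rfl, .inr (by simp [Stmt.seqs, den])⟩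
  | succ k ih =>
    have h1 := h s hs
    have h2 := h1.trans (ih h1.1)
    rw [add_mul, one_mul, add_comm]
    exact h2

end Stmt

/-! ### Access to the adjacency matrix -/

/-- Array `0` is the adjacency matrix, and array `1` contains the indices of the row starts. -/
structure HasMatrix (n : ℕ) (A : ℕ → ℕ → Prop) (a : ℕ → ℕ → ℕ) : Prop where
  row : ∀ u < n, a 1 u = u * n
  adj : ∀ u < n, ∀ v < n, a 0 (u * n + v) = 0 ↔ ¬ A u v

theorem HasMatrix.congr {n : ℕ} {A : ℕ → ℕ → Prop} {a a' : ℕ → ℕ → ℕ}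
    (h : HasMatrix n A a) (h0 : a' 0 = a 0) (h1 : a' 1 = a 1) : HasMatrix n A a' := by
  refine ⟨?_, ?_⟩
  · rw [h1]; exact h.row
  · rw [h0]; exact h.adj

namespace Expr

/-- The index of the matrix entry whose position is given by two registers. -/
def pair (x y : ℕ) : Expr := .add (.get 1 (.var x)) (.var y)

end Expr

theorem pair_lt {n u v : ℕ} (hu : u < n) (hv : v < n) : u * n + v < n * n := by
  nlinarith

theorem pair_inj {n u v u' v' : ℕ} (hv : v < n) (hv' : v' < n) (h : u * n + v = u' * n + v') :
    u = u' ∧ v = v' := by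
  have h1 : u = u' := by
    have h2 : (v + n * u) / n = (v' + n * u') / n := by
      rw [mul_comm n, mul_comm n, add_comm v, add_comm v', h]
    rwa [Nat.add_mul_div_left _ _ (by omega), Nat.add_mul_div_left _ _ (by omega),
      Nat.div_eq_of_lt hv, Nat.div_eq_of_lt hv', zero_add, zero_add] at h2
  subst h1
  exact ⟨rfl, by omega⟩

theorem pair_eval {n : ℕ} {A : ℕ → ℕ → Prop} {s : Store} (h0 : s.reg 1 = n * n)
    (h : HasMatrix n A s.arr) {x y : ℕ} (hx : s.reg x < n) (hy : s.reg y < n) :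
    (Expr.pair x y).eval s = s.reg x * n + s.reg y := by
  have h1 : (Expr.get 1 (.var x)).eval s = s.reg x * n := h.row _ hx
  have h2 := pair_lt hx hy
  rw [Expr.pair, Expr.add_eval, h1]
  · rfl
  · rw [h1, h0, Expr.var_eval]
    exact h2.le

namespace Stmt

/-- Compute the row starts in array `1`, and `n * n` in register `1`. -/
def setup : Stmt :=
  .loop 4 (.seq (.write 1 (.var 4) (.var 1)) (.loop 5 (.assign 1 (.succ (.var 1)))))

theorem setup_spec {s : Store} (h : s.reg 1 = 0) :
    (setup.den s).reg 1 = s.reg 0 * s.reg 0 ∧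
      ∀ u < s.reg 0, (setup.den s).arr 1 u = u * s.reg 0 := by
  set n := s.reg 0 with hn
  have := den_loop_induction (i := 4)
    (c := .seq (.write 1 (.var 4) (.var 1)) (.loop 5 (.assign 1 (.succ (.var 1))))) (s := s)
    (fun k s' => s'.reg 0 = n ∧ s'.reg 1 = k * n ∧ ∀ u < k, s'.arr 1 u = u * n)
    (by simp [h, hn]) (by
      rintro k s' hk hik ⟨h0, h1, h2⟩
      have key : ∀ s'', s''.reg 0 = n →
          ((Stmt.loop 5 (.assign 1 (.succ (.var 1)))).den s'').reg 1 = s''.reg 1 + n := by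
        intro s'' h''
        have := den_loop_induction (i := 5) (c := .assign 1 (.succ (.var 1))) (s := s'')
          (fun k s' => s'.reg 1 = s''.reg 1 + k) (by simp) (by
            intro k s' _ _ hI
            simp [den, hI]
            omega)
        rwa [h''] at this
      refine ⟨?_, ?_, ?_⟩
      · rw [Store.setReg_reg_of_ne _ _ (by omega), den_reg rfl, h0]
      · rw [Store.setReg_reg_of_ne _ _ (by omega), den, key _ (by rw [den_reg rfl, h0]),
          den_reg rfl, h1]
        ring
      · intro u hu
        rw [Store.setReg_arr, den, den_arr rfl]
        simp only [den, Store.setArr_arr, if_true, Expr.var_eval, hik, Function.update_apply, h1]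
        split_ifs with h3
        · rw [h3]
        · exact h2 u (by omega))
  exact this.2

end Stmt

end

section

/-! ### The search for windmills -/

namespace Expr

/-- Adjacency of the vertices in two registers. -/
def adj (x y : ℕ) : Expr := .get 0 (.pair x y)

/-- Entry of an array at the vertex in a register. -/
def entry (a x : ℕ) : Expr := .get a (.var x)

end Expr

theorem adj_eval {n : ℕ} {A : ℕ → ℕ → Prop} {s : Store} (h0 : s.reg 1 = n * n)
    (h : HasMatrix n A s.arr) {x y : ℕ} (hx : s.reg x < n) (hy : s.reg y < n) :
    (Expr.adj x y).eval s = 0 ↔ ¬ A (s.reg x) (s.reg y) := by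
  rw [Expr.adj, Expr.get_eval, pair_eval h0 h hx hy, h.adj _ hx _ hy]

@[simp] theorem entry_eval (s : Store) (a x : ℕ) :
    (Expr.entry a x).eval s = s.arr a (s.reg x) := rfl

namespace Stmt

/-- Set register `9` to a value other than `0` if `e` is true for some value of register `12`. -/
def search (e : Expr) : Stmt :=
  .seq (.assign 9 (.const 0)) (.loop 12 (.ite e (.assign 9 (.const 1)) .skip))

theorem search_spec {e : Expr} {s : Store} {P : ℕ → Prop}
    (he : ∀ s', (∀ x, x ≠ 9 → x ≠ 12 → s'.reg x = s.reg x) → s'.arr = s.arr →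
      (e.eval s' = 0 ↔ ¬ P (s'.reg 12))) :
    ((search e).den s).reg 9 = 0 ↔ ∀ k < s.reg 0, ¬ P k := by
  have := den_loop_induction (i := 12) (c := .ite e (.assign 9 (.const 1)) .skip)
    (s := s.setReg 9 0)
    (fun k s' => (∀ x, x ≠ 9 → x ≠ 12 → s'.reg x = s.reg x) ∧ s'.arr = s.arr ∧
      (s'.reg 9 = 0 ↔ ∀ j < k, ¬ P j))
    ⟨fun x h9 h12 => by simp [h9, h12], by simp, by simp⟩ (by
      rintro k s' hk hik ⟨h1, h2, h3⟩
      have h4 := he s' h1 h2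
      rw [hik] at h4
      rw [Nat.forall_lt_succ_right, ← h3, ← h4]
      by_cases h5 : e.eval s' = 0
      · rw [den_ite_of_eq_zero h5, den]
        refine ⟨fun x h9 h12 => ?_, ?_, ?_⟩
        · simpa [h12] using h1 x h9 h12
        · simpa using h2
        · simp [h5]
      · rw [den_ite_of_ne_zero h5, den]
        refine ⟨fun x h9 h12 => ?_, ?_, ?_⟩
        · simpa [h12, h9] using h1 x h9 h12
        · simpa using h2
        · simp [h5])
  exact this.2.2

/-- The vertices in the registers `4`, `5`, `6` form a triangle, and the first two of them belong
to no windmill. -/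
def isFreeTriangle : Expr :=
  .and (.adj 4 5) (.and (.adj 4 6) (.and (.adj 5 6)
    (.and (.not (.entry 2 4)) (.not (.entry 2 5)))))

/-- The vertex in register `12` belongs to the windmill with the centre in register `10`, but not
to its triangle through the vertices in the registers `6` and `11`. -/
def isFurtherVertex : Expr :=
  .and (.eq (.entry 2 12) (.succ (.var 10))) (.and (.not (.eq (.var 12) (.var 10)))
    (.and (.not (.eq (.var 12) (.var 6))) (.not (.eq (.var 12) (.var 11)))))

/-- Remove the triangle of the vertices in the registers `6` and `11`. -/
def removeTriangle : Stmt :=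
  .seq (.write 2 (.var 11) (.const 0)) (.write 2 (.var 6) (.const 0))

/-- Make the vertex in register `6` the centre of its triangle. -/
def recenterTriangle : Stmt :=
  .seq (.write 2 (.var 10) (.succ (.var 6))) (.seq (.write 2 (.var 11) (.succ (.var 6)))
    (.seq (.write 2 (.var 6) (.succ (.var 6))) (.seq (.write 3 (.var 10) (.var 11))
      (.write 3 (.var 11) (.var 10)))))

/-- Turn the vertex in register `6` into a centre, or remove it from its windmill. -/
def releaseVertex : Stmt :=
  .ite (.or (.not (.entry 2 6)) (.eq (.entry 2 6) (.succ (.var 6)))) .skip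
    (.seq (.assign 10 (.sub (.entry 2 6) (.const 1))) (.seq (.assign 11 (.entry 3 6))
      (.seq (search isFurtherVertex) (.ite (.var 9) removeTriangle recenterTriangle))))

/-- Add the triangle in the registers `4`, `5`, `6`, with the last vertex as centre. -/
def addTriangle : Stmt :=
  .seq (.write 2 (.var 6) (.succ (.var 6))) (.seq (.write 2 (.var 4) (.succ (.var 6)))
    (.seq (.write 2 (.var 5) (.succ (.var 6))) (.seq (.write 3 (.var 4) (.var 5))
      (.write 3 (.var 5) (.var 4)))))

/-- Add a triangle if the first two of its vertices belong to no windmill. -/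
def improve : Stmt := .ite isFreeTriangle (.seq releaseVertex addTriangle) .skip

/-- Improve the windmills as long as possible.  There are `2 * n` rounds, and each increases the
number of covered vertices until nothing changes. -/
def findWindmills : Stmt := .loop 7 (.seqs (List.replicate 2 (sweep improve)))

variable {n : ℕ} {A : ℕ → ℕ → Prop}

open Function (update)

theorem addTriangle_arr (s : Store) :
    ((addTriangle.den s).arr 2 = update (update (update (s.arr 2) (s.reg 6) (s.reg 6 + 1))
      (s.reg 4) (s.reg 6 + 1)) (s.reg 5) (s.reg 6 + 1)) ∧
    (addTriangle.den s).arr 3 = update (update (s.arr 3) (s.reg 4) (s.reg 5)) (s.reg 5)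
      (s.reg 4) := by
  constructor <;> simp [addTriangle, den]

/-- After the release of `v`, the windmills can be extended by a triangle with centre `v`. -/
theorem releaseVertex_spec (hA : IsGraph n A) {s : Store} (hn : s.reg 0 = n)
    (hW : IsWindmills n A (s.arr 2) (s.arr 3)) {w u v : ℕ} (hv : s.reg 6 = v) (hvn : v < n)
    (hw : s.arr 2 w = 0) (hu : s.arr 2 u = 0) (hwv : w ≠ v) (huv : u ≠ v) :
    IsWindmills n A ((releaseVertex.den s).arr 2) ((releaseVertex.den s).arr 3) ∧
    (releaseVertex.den s).arr 2 w = 0 ∧ (releaseVertex.den s).arr 2 u = 0 ∧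
    ((releaseVertex.den s).arr 2 v = 0 ∨ (releaseVertex.den s).arr 2 v = v + 1) ∧
    covered n (s.arr 2) ≤ covered n (update ((releaseVertex.den s).arr 2) v (v + 1)) + 1 := by
  rw [releaseVertex]
  by_cases h1 : s.arr 2 v = 0 ∨ s.arr 2 v = v + 1
  · have he : (Expr.or (.not (.entry 2 6)) (.eq (.entry 2 6) (.succ (.var 6)))).eval s ≠ 0 := by
      rw [Ne, Expr.or_eval, Expr.not_eval, Expr.eq_eval]
      simp only [entry_eval, Expr.succ_eval, Expr.var_eval, hv]
      tauto
    rw [den_ite_of_ne_zero he, den]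
    exact ⟨hW, hw, hu, h1, (covered_le_update v.succ_ne_zero v).trans (Nat.le_succ _)⟩
  have he : (Expr.or (.not (.entry 2 6)) (.eq (.entry 2 6) (.succ (.var 6)))).eval s = 0 := by
    rw [Expr.or_eval, Expr.not_eval, Expr.eq_eval]
    simp only [entry_eval, Expr.succ_eval, Expr.var_eval, hv]
    tauto
  push Not at h1
  obtain ⟨x, hx⟩ := Nat.exists_eq_succ_of_ne_zero h1.1
  have hvx : v ≠ x := by omega
  obtain ⟨s₁, hs₁⟩ : ∃ s₁, s₁ = (s.setReg 10 ((Expr.sub (.entry 2 6) (.const 1)).eval s)).setReg 11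
    ((Expr.entry 3 6).eval (s.setReg 10 ((Expr.sub (.entry 2 6) (.const 1)).eval s))) := ⟨_, rfl⟩
  have hden : (Stmt.seq (.assign 10 (.sub (.entry 2 6) (.const 1))) (.seq (.assign 11 (.entry 3 6))
      (.seq (search isFurtherVertex) (.ite (.var 9) removeTriangle recenterTriangle)))).den s =
      (Stmt.ite (.var 9) removeTriangle recenterTriangle).den
        ((search isFurtherVertex).den s₁) := by
    rw [hs₁]; rfl
  rw [den_ite_of_eq_zero he, hden]
  have h6 : s₁.reg 6 = v := by simp [hs₁, hv]
  have h10 : s₁.reg 10 = x := by simp [hs₁, hv, hx]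
  have h11 : s₁.reg 11 = s.arr 3 v := by simp [hs₁, hv]
  have h0 : s₁.reg 0 = n := by simp [hs₁, hn]
  have harr : s₁.arr = s.arr := by simp [hs₁]
  have hsearch := search_spec (e := isFurtherVertex) (s := s₁)
    (P := fun z => s.arr 2 z = x + 1 ∧ z ≠ x ∧ z ≠ v ∧ z ≠ s.arr 3 v) (by
      intro s' hreg harr'
      simp only [isFurtherVertex, Expr.and_eval, Expr.eq_eval, Expr.not_eval, entry_eval,
        Expr.succ_eval, Expr.var_eval, hreg 10 (by omega) (by omega), hreg 6 (by omega) (by omega),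
        hreg 11 (by omega) (by omega), harr', harr, h6, h10, h11, Ne, not_not])
  rw [h0] at hsearch
  set s₂ := (search isFurtherVertex).den s₁ with hs₂
  have k6 : s₂.reg 6 = v := by rw [hs₂, den_reg rfl, h6]
  have k10 : s₂.reg 10 = x := by rw [hs₂, den_reg rfl, h10]
  have k11 : s₂.reg 11 = s.arr 3 v := by rw [hs₂, den_reg rfl, h11]
  have k2 : s₂.arr 2 = s.arr 2 := by rw [hs₂, den_arr rfl, harr]
  have k3 : s₂.arr 3 = s.arr 3 := by rw [hs₂, den_arr rfl, harr]
  obtain ⟨l1, l2, l3, l4, l5, l6⟩ := hW.leaf v hvn x hx hvx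
  obtain ⟨hxn, hxx⟩ := hW.center v hvn x hx
  by_cases h9 : s₂.reg 9 = 0
  · have hz := hsearch.1 h9
    rw [den_ite_of_eq_zero (e := .var 9) h9]
    have e2 : (recenterTriangle.den s₂).arr 2 =
        update (update (update (s.arr 2) x (v + 1)) (s.arr 3 v) (v + 1)) v (v + 1) := by
      simp [recenterTriangle, den, k6, k10, k11, k2]
    have e3 : (recenterTriangle.den s₂).arr 3 =
        update (update (s.arr 3) x (s.arr 3 v)) (s.arr 3 v) x := by
      simp [recenterTriangle, den, k10, k11, k3]
    have hW' := hW.recenter hA hvn hx hvx (by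
      intro z hzn hzx
      have := hz z hzn
      omega)
    rw [e2, e3]
    have hz0 : ∀ z, s.arr 2 z = 0 → z ≠ v →
        update (update (update (s.arr 2) x (v + 1)) (s.arr 3 v) (v + 1)) v (v + 1) z = 0 := by
      intro z hz hzv
      have hzx : z ≠ x := by rintro rfl; omega
      have hzm : z ≠ s.arr 3 v := by rintro rfl; omega
      simp [hzx, hzm, hzv, hz]
    refine ⟨hW', hz0 w hw hwv, hz0 u hu huv, .inr (by simp), ?_⟩
    have c1 := covered_le_update (n := n) (ct := s.arr 2) (c := v + 1) (by omega) x
    have c2 := covered_le_update (n := n) (ct := update (s.arr 2) x (v + 1)) (c := v + 1)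
      (by omega) (s.arr 3 v)
    have c3 := covered_le_update (n := n)
      (ct := update (update (s.arr 2) x (v + 1)) (s.arr 3 v) (v + 1)) (c := v + 1) (by omega) v
    rw [Function.update_idem]
    omega
  · have hz := mt hsearch.2 h9
    push Not at hz
    obtain ⟨z, hzn, hz1, hz2, hz3, hz4⟩ := hz
    rw [den_ite_of_ne_zero (e := .var 9) h9]
    have e2 : (removeTriangle.den s₂).arr 2 = update (update (s.arr 2) (s.arr 3 v) 0) v 0 := by
      simp [removeTriangle, den, k6, k11, k2]
    have e3 : (removeTriangle.den s₂).arr 3 = s.arr 3 := by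
      simp [removeTriangle, den, k3]
    rw [e2, e3]
    have hz0 : ∀ z, s.arr 2 z = 0 → update (update (s.arr 2) (s.arr 3 v) 0) v 0 z = 0 := by
      intro z hz
      simp only [Function.update_apply]
      split_ifs <;> simp [hz]
    refine ⟨hW.remove hvn hx hvx hzn hz1 hz2 hz3 hz4, hz0 w hw, hz0 u hu, .inl (by simp), ?_⟩
    have c1 := covered_le_update_zero (n := n) (ct := s.arr 2) (s.arr 3 v)
    have c2 := covered_le_update (n := n) (ct := update (s.arr 2) (s.arr 3 v) 0) (c := v + 1)
      (by omega) v
    rw [Function.update_idem]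
    omega

/-- The arrays hold the adjacency matrix and windmills. -/
def HasWindmills (n : ℕ) (A : ℕ → ℕ → Prop) (a : ℕ → ℕ → ℕ) : Prop :=
  HasMatrix n A a ∧ IsWindmills n A (a 2) (a 3)

theorem improve_spec (hA : IsGraph n A) {s : Store} (hs : Base n (HasWindmills n A) s)
    (h4 : s.reg 4 < n) (h5 : s.reg 5 < n) (h6 : s.reg 6 < n) :
    Improves n (HasWindmills n A) (fun a => covered n (a 2))
      (fun a => ¬ (A (s.reg 4) (s.reg 5) ∧ A (s.reg 4) (s.reg 6) ∧ A (s.reg 5) (s.reg 6) ∧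
        a 2 (s.reg 4) = 0 ∧ a 2 (s.reg 5) = 0)) s (improve.den s) := by
  obtain ⟨h0, h1, hM, hW⟩ := hs
  have he : isFreeTriangle.eval s = 0 ↔ ¬ (A (s.reg 4) (s.reg 5) ∧ A (s.reg 4) (s.reg 6) ∧
      A (s.reg 5) (s.reg 6) ∧ s.arr 2 (s.reg 4) = 0 ∧ s.arr 2 (s.reg 5) = 0) := by
    simp only [isFreeTriangle, Expr.and_eval, Expr.not_eval, entry_eval, adj_eval h1 hM h4 h5,
      adj_eval h1 hM h4 h6, adj_eval h1 hM h5 h6, Ne, not_not]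
  have hbase : ∀ c : Stmt, c.keeps 0 = true → c.keeps 1 = true → c.keepsArr 0 = true →
      c.keepsArr 1 = true → IsWindmills n A ((c.den s).arr 2) ((c.den s).arr 3) →
      Base n (HasWindmills n A) (c.den s) := by
    intro c k0 k1 a0 a1 h
    exact ⟨by rw [den_reg k0, h0], by rw [den_reg k1, h1],
      HasMatrix.congr hM (den_arr a0 s) (den_arr a1 s), h⟩
  by_cases hT : isFreeTriangle.eval s = 0
  · have hden : improve.den s = s := by simp [improve, den, hT]
    rw [hden]
    exact ⟨⟨h0, h1, hM, hW⟩, .inl ⟨he.1 hT, rfl⟩⟩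
  have hT' := not_not.1 (mt he.2 hT)
  obtain ⟨hwu, hwv, huv, hw, hu⟩ := hT'
  have hden : improve.den s = addTriangle.den (releaseVertex.den s) := by simp [improve, den, hT]
  obtain ⟨hW', hw', hu', hv', hcov⟩ := releaseVertex_spec hA h0 hW rfl h6 hw hu
    (by rintro h; rw [h] at hwv; exact hA.irrefl _ hwv)
    (by rintro h; rw [h] at huv; exact hA.irrefl _ huv)
  obtain ⟨e2, e3⟩ := addTriangle_arr (releaseVertex.den s)
  rw [den_reg rfl, den_reg rfl, den_reg rfl] at e2
  rw [den_reg rfl, den_reg rfl] at e3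
  have hadd := hW'.add hA hwu hwv huv hw' hu' hv'
  refine ⟨hbase improve rfl rfl rfl rfl ?_, .inr ⟨fun h => h ⟨hwu, hwv, huv, hw, hu⟩, ?_⟩⟩
  · rw [hden, e2, e3]
    exact hadd
  · have := covered_add (n := n) hA hwu hwv huv hw' hu'
    simp only [hden, e2]
    omega

/-- The search ends with windmills that cannot be improved. -/
theorem findWindmills_spec (hA : IsGraph n A) {s : Store} (hs : Base n (HasWindmills n A) s) :
    Base n (HasWindmills n A) (findWindmills.den s) ∧
      IsMaximal A ((findWindmills.den s).arr 2) := by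
  have := Progress.loop (i := 7) (by omega) (c := .seqs (List.replicate 2 (sweep improve)))
    (fun s hs => Progress.replicate (fun s hs =>
      (Improves.sweep (Φ := fun a => covered n (a 2)) (g := fun w u v a =>
        ¬ (A w u ∧ A w v ∧ A u v ∧ a 2 w = 0 ∧ a 2 u = 0)) rfl rfl
        (fun s hs h4 h5 h6 => improve_spec hA hs h4 h5 h6) hs).progress) 2 hs)
    hs
  obtain ⟨h1, -, h2⟩ := this
  refine ⟨h1, fun w u v hwu hwv huv hw hu => ?_⟩
  have hwn := hA.lt _ _ hwu
  have hun := hA.lt _ _ huv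
  have hvn := hA.lt _ _ (hA.symm _ _ huv)
  rcases h2 with h2 | h2
  · exact h2 w hwn u hun v hvn ⟨hwu, hwv, huv, hw, hu⟩
  · have := covered_le n ((findWindmills.den s).arr 2)
    change _ ≤ covered n ((findWindmills.den s).arr 2) at h2
    omega

end Stmt

end

section

/-! ### The table of colour pairs -/

/-- The pairs of colours. -/
def colourPairs : List (ℕ × ℕ) :=
  [(0, 0), (0, 1), (0, 2), (1, 0), (1, 1), (1, 2), (2, 0), (2, 1), (2, 2)]

theorem mem_colourPairs {p : ℕ × ℕ} : p ∈ colourPairs ↔ p.1 < 3 ∧ p.2 < 3 := by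
  obtain ⟨a, b⟩ := p
  simp only [colourPairs, List.mem_cons, Prod.mk.injEq, List.not_mem_nil, or_false]
  omega

/-- The pair of colours `a` at `u` and `b` at `v` is not excluded.  There is one array for each pair
of colours, with entries other than `0` for the excluded pairs. -/
def Alive (n : ℕ) (t : ℕ → ℕ → ℕ) (a b u v : ℕ) : Prop := t (5 + 3 * a + b) (u * n + v) = 0

/-- The table entry for the colours `a` and `b` at the vertices in the registers `x` and `y`. -/
def Expr.cell (a b x y : ℕ) : Expr := .get (5 + 3 * a + b) (.pair x y)

variable {n : ℕ} {A : ℕ → ℕ → Prop}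

theorem cell_eval {s : Store} (h0 : s.reg 1 = n * n) (h : HasMatrix n A s.arr) {x y : ℕ}
    (hx : s.reg x < n) (hy : s.reg y < n) (a b : ℕ) :
    (Expr.cell a b x y).eval s = 0 ↔ Alive n s.arr a b (s.reg x) (s.reg y) := by
  rw [Expr.cell, Expr.get_eval, pair_eval h0 h hx hy, Alive]

namespace Stmt

/-- In passing from the memory `s` to `s'`, no property in the family `Q` gets lost, and those with
an index in `S` hold in `s'`, which satisfies the invariant `J`. -/
def Establishes {κ : Type} (n : ℕ) (J : (ℕ → ℕ → ℕ) → Prop) (Q : κ → (ℕ → ℕ → ℕ) → Prop)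
    (S : Set κ) (s s' : Store) : Prop :=
  Base n J s' ∧ (∀ k, Q k s.arr → Q k s'.arr) ∧ ∀ k ∈ S, Q k s'.arr

section Establishes

variable {κ : Type} {J : (ℕ → ℕ → ℕ) → Prop} {Q : κ → (ℕ → ℕ → ℕ) → Prop}

theorem Establishes.trans {S S' : Set κ} {s s' s'' : Store} (h : Establishes n J Q S s s')
    (h' : Establishes n J Q S' s' s'') : Establishes n J Q (S ∪ S') s s'' := by
  refine ⟨h'.1, fun k hk => h'.2.1 k (h.2.1 k hk), ?_⟩
  rintro k (hk | hk)
  · exact h'.2.1 k (h.2.2 k hk)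
  · exact h'.2.2 k hk

theorem Establishes.mono {S S' : Set κ} {s s' : Store} (h : Establishes n J Q S s s')
    (hS : S' ⊆ S) : Establishes n J Q S' s s' :=
  ⟨h.1, h.2.1, fun k hk => h.2.2 k (hS hk)⟩

theorem Establishes.seqs {ι : Type} (l : List ι) (c : ι → Stmt) (S : ι → Set κ)
    (P : Store → Prop) (hP : ∀ i ∈ l, ∀ s, P s → P ((c i).den s))
    (h : ∀ i ∈ l, ∀ s, Base n J s → P s → Establishes n J Q (S i) s ((c i).den s))
    {s : Store} (hs : Base n J s) (hPs : P s) :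
    Establishes n J Q {k | ∃ i ∈ l, k ∈ S i} s ((Stmt.seqs (l.map c)).den s) := by
  induction l generalizing s with
  | nil => exact ⟨hs, fun _ h => h, by simp⟩
  | cons i l ih =>
    have h1 := h i (by simp) s hs hPs
    have h2 := ih (fun j hj => hP j (by simp [hj])) (fun j hj => h j (by simp [hj])) h1.1
      (hP i (by simp) s hPs)
    refine (h1.trans h2).mono ?_
    rintro k ⟨j, hj, hk⟩
    rcases List.mem_cons.1 hj with rfl | hj
    · exact .inl hk
    · exact .inr ⟨j, hj, hk⟩

theorem Establishes.loop {i : ℕ} (hi : 2 ≤ i) {c : Stmt} {S : ℕ → Set κ}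
    (P : Store → Prop) (hP : ∀ s, P s → P (c.den s)) (hPi : ∀ s k, P s → P (s.setReg i k))
    (h : ∀ s, Base n J s → P s → s.reg i < n → Establishes n J Q (S (s.reg i)) s (c.den s))
    {s : Store} (hs : Base n J s) (hPs : P s) :
    Establishes n J Q {k | ∃ j < n, k ∈ S j} s ((Stmt.loop i c).den s) := by
  have := den_loop_induction (i := i) (c := c) (s := s)
    (fun k s' => P s' ∧ Establishes n J Q {q | ∃ j < k, q ∈ S j} s s')
    ⟨hPi _ _ hPs, hs.setReg hi, fun _ h => h, by simp⟩ (by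
      rintro k s' hk rfl ⟨hPs', hI⟩
      have h1 := hI.trans (h s' hI.1 hPs' (by rw [← hs.1]; exact hk))
      refine ⟨hPi _ _ (hP _ hPs'), h1.1.setReg hi, h1.2.1, ?_⟩
      rintro q ⟨j, hj, hq⟩
      apply h1.2.2
      rcases Nat.lt_succ_iff_lt_or_eq.1 hj with hj | rfl
      · exact .inl ⟨j, hj, hq⟩
      · exact .inr hq)
  rw [hs.1] at this
  exact this.2

end Establishes

instance (a b : ℕ) : Decidable (Compatible a b) :=
  inferInstanceAs (Decidable (¬ (a = 1 ∧ b = 1) ∧ ¬ (a = 0 ∧ b = 2) ∧ ¬ (a = 2 ∧ b = 0)))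

/-- The bit of the vertex in register `4`. -/
def bitExpr : Expr := .or (.entry 4 4) (.get 4 (.entry 3 4))

/-- The colour `a` is forbidden at the vertex in register `4`. -/
def forbidden (a : ℕ) : Expr :=
  .and (.entry 2 4) (.and (.not (.eq (.entry 2 4) (.succ (.var 4))))
    (.or (.and bitExpr (.eq (.const a) (.const 0)))
      (.and (.not bitExpr) (.eq (.const a) (.const 2)))))

/-- The colours `a` and `b` are allowed at the vertices in the registers `4` and `5`. -/
def allowed (a b : ℕ) : Expr :=
  .and (.or (.not (.eq (.var 4) (.var 5))) (.eq (.const a) (.const b)))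
    (.and (.or (.not (.adj 4 5)) (.const (if Compatible a b then 1 else 0))) (.not (forbidden a)))

theorem forbidden_eval (s : Store) (a : ℕ) :
    (forbidden a).eval s = 0 ↔ ¬ Forbidden (s.arr 2) (s.arr 3) (s.arr 4) (s.reg 4) a := by
  simp only [forbidden, bitExpr, Forbidden, Expr.and_eval, Expr.or_eval, Expr.not_eval,
    Expr.eq_eval, entry_eval, Expr.get_eval, Expr.succ_eval, Expr.var_eval, Expr.const_eval, Ne,
    not_not]
  grind

theorem allowed_eval {s : Store} (h1 : s.reg 1 = n * n) (hM : HasMatrix n A s.arr)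
    (h4 : s.reg 4 < n) (h5 : s.reg 5 < n) (a b : ℕ) :
    (allowed a b).eval s = 0 ↔
      ¬ Allowed A (s.arr 2) (s.arr 3) (s.arr 4) a b (s.reg 4) (s.reg 5) := by
  have : (if Compatible a b then 1 else 0) = 0 ↔ ¬ Compatible a b := by split_ifs <;> simp_all
  simp only [allowed, Allowed, Expr.and_eval, Expr.or_eval, Expr.not_eval,
    Expr.eq_eval, adj_eval h1 hM h4 h5, Expr.var_eval, Expr.const_eval, forbidden_eval, this, Ne,
    not_not]
  grind

/-- Initialize a table entry. -/
def initCell (p : ℕ × ℕ) : Stmt :=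
  .ite (allowed p.1 p.2) (.write (5 + 3 * p.1 + p.2) (.pair 4 5) (.const 0))
    (.write (5 + 3 * p.1 + p.2) (.pair 4 5) (.const 1))

/-- Initialize the table with the pairs that are not immediately excluded. -/
def initTable : Stmt := .loop 4 (.loop 5 (.seqs (colourPairs.map initCell)))

theorem initCell_spec (t : ℕ → ℕ → ℕ) {s : Store}
    (hs : Base n (fun a => HasMatrix n A a ∧ ∀ q < 5, a q = t q) s)
    (h4 : s.reg 4 < n) (h5 : s.reg 5 < n) {p : ℕ × ℕ} (hp : p ∈ colourPairs) :
    Establishes n (fun a => HasMatrix n A a ∧ ∀ q < 5, a q = t q)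
      (fun (k : (ℕ × ℕ) × ℕ × ℕ) a => k.1.2 < 3 → k.2.2 < n → (Alive n a k.1.1 k.1.2 k.2.1 k.2.2 ↔
        Allowed A (t 2) (t 3) (t 4) k.1.1 k.1.2 k.2.1 k.2.2))
      {(p, s.reg 4, s.reg 5)} s ((initCell p).den s) := by
  obtain ⟨h0, h1, hM, ht⟩ := hs
  have hden : (initCell p).den s = s.setArr (5 + 3 * p.1 + p.2) (s.reg 4 * n + s.reg 5)
      (if (allowed p.1 p.2).eval s = 0 then 1 else 0) := by
    rw [initCell]
    by_cases h : (allowed p.1 p.2).eval s = 0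
    · rw [den_ite_of_eq_zero h, den, pair_eval h1 hM h4 h5, if_pos h, Expr.const_eval]
    · rw [den_ite_of_ne_zero h, den, pair_eval h1 hM h4 h5, if_neg h, Expr.const_eval]
  have hal := allowed_eval h1 hM h4 h5 p.1 p.2
  rw [ht 2 (by omega), ht 3 (by omega), ht 4 (by omega)] at hal
  have hp3 := mem_colourPairs.1 hp
  have hnew : Alive n ((initCell p).den s).arr p.1 p.2 (s.reg 4) (s.reg 5) ↔
      Allowed A (t 2) (t 3) (t 4) p.1 p.2 (s.reg 4) (s.reg 5) := by
    rw [hden, Alive, Store.setArr_arr, if_pos rfl, Function.update_self]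
    split_ifs with h
    · simpa using hal.1 h
    · simpa using mt hal.2 h
  have harr : ∀ q < 5, ((initCell p).den s).arr q = s.arr q := by
    intro q hq
    rw [hden, Store.setArr_arr, if_neg (by omega)]
  refine ⟨⟨by rw [hden]; exact h0, by rw [hden]; exact h1,
    hM.congr (harr 0 (by omega)) (harr 1 (by omega)), fun q hq => (harr q hq).trans (ht q hq)⟩,
    ?_, ?_⟩
  · rintro ⟨⟨a, b⟩, u, v⟩ hk hb hv
    by_cases heq : 5 + 3 * a + b = 5 + 3 * p.1 + p.2 ∧ u * n + v = s.reg 4 * n + s.reg 5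
    · obtain ⟨e1, e2⟩ := heq
      obtain ⟨rfl, rfl⟩ := pair_inj hv h5 e2
      obtain ⟨rfl, rfl⟩ : a = p.1 ∧ b = p.2 := by dsimp only at hb; omega
      exact hnew
    · rw [← hk hb hv, hden, Alive, Alive, Store.setArr_arr]
      by_cases e1 : 5 + 3 * a + b = 5 + 3 * p.1 + p.2
      · rw [if_pos e1, Function.update_of_ne (fun e2 => heq ⟨e1, e2⟩), e1]
      · rw [if_neg e1]
  · rintro _ rfl _ _
    exact hnew

theorem initTable_spec (t : ℕ → ℕ → ℕ) {s : Store}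
    (hs : Base n (fun a => HasMatrix n A a ∧ ∀ q < 5, a q = t q) s) :
    Base n (fun a => HasMatrix n A a ∧ ∀ q < 5, a q = t q) (initTable.den s) ∧
      ∀ a < 3, ∀ b < 3, ∀ u < n, ∀ v < n, Alive n (initTable.den s).arr a b u v ↔
        Allowed A (t 2) (t 3) (t 4) a b u v := by
  have := Establishes.loop (n := n) (i := 4) (by omega)
    (c := .loop 5 (.seqs (colourPairs.map initCell)))
    (J := fun a => HasMatrix n A a ∧ ∀ q < 5, a q = t q)
    (Q := fun (k : (ℕ × ℕ) × ℕ × ℕ) a => k.1.2 < 3 → k.2.2 < n →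
      (Alive n a k.1.1 k.1.2 k.2.1 k.2.2 ↔
        Allowed A (t 2) (t 3) (t 4) k.1.1 k.1.2 k.2.1 k.2.2))
    (S := fun u => {k | ∃ v < n, ∃ p ∈ colourPairs, k = (p, u, v)})
    (fun _ => True) (fun _ _ => trivial) (fun _ _ _ => trivial) (by
      intro s hs _ hs4
      generalize hu : s.reg 4 = u at hs4 ⊢
      refine Establishes.loop (i := 5) (by omega)
        (S := fun v => {k | ∃ p ∈ colourPairs, k = (p, u, v)}) (fun s => s.reg 4 = u)
        (fun s h => by rw [den_reg rfl, h]) (fun s k h => by simpa using h) ?_ hs hu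
      intro s hs hu hs5
      generalize hv : s.reg 5 = v at hs5 ⊢
      refine Establishes.seqs colourPairs initCell (fun p => {(p, u, v)})
        (fun s => s.reg 4 = u ∧ s.reg 5 = v)
        (fun p _ s h => by rwa [den_reg rfl, den_reg rfl]) ?_ hs ⟨hu, hv⟩
      rintro p hp s hs ⟨rfl, rfl⟩
      exact initCell_spec t hs hs4 hs5 hp) hs trivial
  refine ⟨this.1, fun a ha b hb u hu v hv => ?_⟩
  exact this.2.2 ((a, b), u, v)
    ⟨u, hu, v, hv, (a, b), mem_colourPairs.2 ⟨ha, hb⟩, rfl⟩ hb hv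

/-! ### The closure under path consistency -/

/-- The colours `a` and `b` at the vertices in the registers `4` and `5` are not excluded, but do
not extend to the vertex in register `6`. -/
def inconsistent (a b : ℕ) : Expr :=
  .and (.not (.cell a b 4 5)) (.and (.or (.cell a 0 4 6) (.cell b 0 5 6))
    (.and (.or (.cell a 1 4 6) (.cell b 1 5 6)) (.or (.cell a 2 4 6) (.cell b 2 5 6))))

/-- Exclude a pair of colours if it does not extend. -/
def exclude (p : ℕ × ℕ) : Stmt :=
  .ite (inconsistent p.1 p.2) (.write (5 + 3 * p.1 + p.2) (.pair 4 5) (.const 1)) .skip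

/-- Exclude pairs of colours as long as possible.  There are `10 * n ^ 2` rounds, more than the
`9 * n ^ 2` entries of the table. -/
def closeTable : Stmt :=
  .loop 7 (.loop 8 (.seqs (List.replicate 10 (sweep (.seqs (colourPairs.map exclude))))))

/-- The number of excluded pairs. -/
def excluded (n : ℕ) (t : ℕ → ℕ → ℕ) : ℕ :=
  ((Finset.range 3 ×ˢ Finset.range 3 ×ˢ Finset.range (n * n)).filter
    fun k => t (5 + 3 * k.1 + k.2.1) k.2.2 ≠ 0).card

theorem excluded_le (n : ℕ) (t : ℕ → ℕ → ℕ) : excluded n t ≤ 9 * (n * n) := by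
  refine (Finset.card_filter_le _ _).trans ?_
  simp only [Finset.card_product, Finset.card_range]
  omega

/-- All pairs in the table are allowed, and all pairs of colours that occur in allowed colourings
are in the table. -/
def IsTable (n : ℕ) (A : ℕ → ℕ → Prop) (ct mt bit : ℕ → ℕ) (t : ℕ → ℕ → ℕ) : Prop :=
  HasMatrix n A t ∧
    (∀ a < 3, ∀ b < 3, ∀ u < n, ∀ v < n, Alive n t a b u v → Allowed A ct mt bit a b u v) ∧
    ∀ f : ℕ → ℕ, (∀ u < n, f u < 3) →
      (∀ u < n, ∀ v < n, Allowed A ct mt bit (f u) (f v) u v) →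
      ∀ u < n, ∀ v < n, Alive n t (f u) (f v) u v

variable {ct mt bit : ℕ → ℕ}

theorem exclude_spec {s : Store} (hs : Base n (IsTable n A ct mt bit) s)
    (h4 : s.reg 4 < n) (h5 : s.reg 5 < n) (h6 : s.reg 6 < n) {p : ℕ × ℕ} (hp : p ∈ colourPairs) :
    Improves n (IsTable n A ct mt bit) (excluded n)
      (fun t => Alive n t p.1 p.2 (s.reg 4) (s.reg 5) →
        ∃ c < 3, Alive n t p.1 c (s.reg 4) (s.reg 6) ∧ Alive n t p.2 c (s.reg 5) (s.reg 6))
      s ((exclude p).den s) := by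
  obtain ⟨h0, h1, hM, ht, hf⟩ := hs
  have he : (inconsistent p.1 p.2).eval s = 0 ↔ (Alive n s.arr p.1 p.2 (s.reg 4) (s.reg 5) →
      ∃ c < 3, Alive n s.arr p.1 c (s.reg 4) (s.reg 6) ∧
        Alive n s.arr p.2 c (s.reg 5) (s.reg 6)) := by
    have h3 : ∀ q : ℕ → Prop, (∃ c < 3, q c) ↔ q 0 ∨ q 1 ∨ q 2 := by
      intro q
      constructor
      · rintro ⟨c, hc, hq⟩
        interval_cases c <;> simp [hq]
      · rintro (h | h | h)
        exacts [⟨0, by omega, h⟩, ⟨1, by omega, h⟩, ⟨2, by omega, h⟩]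
    simp only [inconsistent, Expr.and_eval, Expr.or_eval, Expr.not_eval, cell_eval h1 hM h4 h5,
      cell_eval h1 hM h4 h6, cell_eval h1 hM h5 h6, Ne, h3]
    tauto
  by_cases h : (inconsistent p.1 p.2).eval s = 0
  · rw [exclude, den_ite_of_eq_zero h, den]
    exact ⟨⟨h0, h1, hM, ht, hf⟩, .inl ⟨he.1 h, rfl⟩⟩
  have hden : (exclude p).den s =
      s.setArr (5 + 3 * p.1 + p.2) (s.reg 4 * n + s.reg 5) 1 := by
    rw [exclude, den_ite_of_ne_zero h, den, pair_eval h1 hM h4 h5, Expr.const_eval]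
  have hne := h
  rw [he] at hne
  have hp3 := mem_colourPairs.1 hp
  have harr : ∀ q < 5, ((exclude p).den s).arr q = s.arr q := by
    intro q hq
    rw [hden, Store.setArr_arr, if_neg (by omega)]
  have hcell : ∀ q k, ((exclude p).den s).arr q k =
      if q = 5 + 3 * p.1 + p.2 ∧ k = s.reg 4 * n + s.reg 5 then 1 else s.arr q k := by
    intro q k
    rw [hden, Store.setArr_arr]
    by_cases e1 : q = 5 + 3 * p.1 + p.2
    · simp [e1, Function.update_apply]
    · simp [e1]
  push Not at hne
  obtain ⟨hal, hno⟩ := hne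
  refine ⟨⟨by rw [hden]; exact h0, by rw [hden]; exact h1,
    hM.congr (harr 0 (by omega)) (harr 1 (by omega)), ?_, ?_⟩,
    .inr ⟨by push Not; exact ⟨hal, hno⟩, ?_⟩⟩
  · intro a ha b hb u hu v hv h
    apply ht a ha b hb u hu v hv
    rw [Alive, hcell] at h
    split_ifs at h
    exact h
  · intro f hf3 hfa u hu v hv
    rw [Alive, hcell, if_neg]
    · exact hf f hf3 hfa u hu v hv
    rintro ⟨e1, e2⟩
    obtain ⟨rfl, rfl⟩ := pair_inj hv h5 e2
    have h7 := hf3 _ hv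
    obtain ⟨e3, e4⟩ : p.1 = f (s.reg 4) ∧ p.2 = f (s.reg 5) := by omega
    rw [e3, e4] at hno
    exact hno _ (hf3 _ h6) (hf f hf3 hfa _ h4 _ h6) (hf f hf3 hfa _ h5 _ h6)
  · apply Finset.card_lt_card
    rw [Finset.ssubset_iff_of_subset]
    · refine ⟨(p.1, p.2, s.reg 4 * n + s.reg 5), ?_, ?_⟩
      · simp [hcell, hp3, pair_lt h4 h5]
      · simp only [Finset.mem_filter, not_and, not_not]
        exact fun _ => hal
    · rintro ⟨a, b, k⟩ hk
      simp only [Finset.mem_filter] at hk ⊢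
      refine ⟨hk.1, ?_⟩
      rw [hcell]
      split_ifs
      · exact one_ne_zero
      · exact hk.2

theorem closeTable_spec {s : Store} (hs : Base n (IsTable n A ct mt bit) s) :
    Base n (IsTable n A ct mt bit) (closeTable.den s) ∧
      ∀ a < 3, ∀ b < 3, ∀ u < n, ∀ v < n, ∀ w < n, Alive n (closeTable.den s).arr a b u v →
        ∃ c < 3, Alive n (closeTable.den s).arr a c u w ∧
          Alive n (closeTable.den s).arr b c v w := by
  have hsweep : ∀ s, Base n (IsTable n A ct mt bit) s →
      Improves n (IsTable n A ct mt bit) (excluded n) (fun t => ∀ u < n, ∀ v < n, ∀ w < n,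
        ∀ p ∈ colourPairs, Alive n t p.1 p.2 u v →
          ∃ c < 3, Alive n t p.1 c u w ∧ Alive n t p.2 c v w)
      s ((sweep (.seqs (colourPairs.map exclude))).den s) := by
    intro s hs
    refine Improves.sweep (g := fun u v w t => ∀ p ∈ colourPairs, Alive n t p.1 p.2 u v →
          ∃ c < 3, Alive n t p.1 c u w ∧ Alive n t p.2 c v w) rfl rfl ?_ hs
    intro s hs h4 h5 h6
    generalize hu : s.reg 4 = u at h4 ⊢
    generalize hv : s.reg 5 = v at h5 ⊢
    generalize hw : s.reg 6 = w at h6 ⊢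
    refine Improves.seqs colourPairs exclude (fun p t => Alive n t p.1 p.2 u v →
          ∃ c < 3, Alive n t p.1 c u w ∧ Alive n t p.2 c v w)
      (fun s => s.reg 4 = u ∧ s.reg 5 = v ∧ s.reg 6 = w)
      (fun p _ s h => by rwa [den_reg rfl, den_reg rfl, den_reg rfl]) ?_ hs ⟨hu, hv, hw⟩
    rintro p hp s hs ⟨rfl, rfl, rfl⟩
    exact exclude_spec hs h4 h5 h6 hp
  have := Progress.loop (i := 7) (by omega)
    (c := .loop 8 (.seqs (List.replicate 10 (sweep (.seqs (colourPairs.map exclude))))))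
    (fun s hs => Progress.loop (i := 8) (by omega) (fun s hs =>
      Progress.replicate (fun s hs => (hsweep s hs).progress) 10 hs) hs) hs
  obtain ⟨h1, -, h2⟩ := this
  refine ⟨h1, fun a ha b hb u hu v hv w hw h => ?_⟩
  rcases h2 with h2 | h2
  · exact h2 u hu v hv w hw (a, b) (mem_colourPairs.2 ⟨ha, hb⟩) h
  · have h3 := excluded_le n (closeTable.den s).arr
    change _ ≤ excluded n (closeTable.den s).arr at h2
    have h4 : 0 < n * n := Nat.mul_pos (by omega) (by omega)
    rw [show n * (n * (10 * 1)) = 10 * (n * n) by ring] at h2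
    omega

/-- Set register `2` to a value other than `0` if the table contains a pair of the colours `0`
and `2`. -/
def checkTable : Stmt :=
  .loop 4 (.loop 5 (.ite (.cell 0 2 4 5) .skip (.assign 2 (.const 1))))

theorem checkTable_spec {s : Store} (hs : Base n (HasMatrix n A) s) :
    (checkTable.den s).reg 2 ≠ 0 ↔
      s.reg 2 ≠ 0 ∨ ∃ u < n, ∃ v < n, Alive n s.arr 0 2 u v := by
  obtain ⟨h0, h1, hM⟩ := hs
  have inner : ∀ u < n, ∀ s', s'.reg 1 = n * n → s'.arr = s.arr → s'.reg 0 = n → s'.reg 4 = u →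
      (((Stmt.loop 5 (.ite (.cell 0 2 4 5) .skip (.assign 2 (.const 1)))).den s').reg 2 ≠ 0 ↔
        s'.reg 2 ≠ 0 ∨ ∃ v < n, Alive n s.arr 0 2 u v) := by
    rintro u hu s' h1' ha' h0' rfl
    have := den_loop_induction (i := 5) (c := .ite (.cell 0 2 4 5) .skip (.assign 2 (.const 1)))
      (s := s') (fun k t => t.reg 1 = n * n ∧ t.arr = s.arr ∧ t.reg 4 = s'.reg 4 ∧
        (t.reg 2 ≠ 0 ↔ s'.reg 2 ≠ 0 ∨ ∃ v < k, Alive n s.arr 0 2 (s'.reg 4) v))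
      (by simp [h1', ha']) (by
        rintro k t hk rfl ⟨k1, k2, k3, k4⟩
        rw [h0'] at hk
        have he := cell_eval k1 (by rw [k2]; exact hM)
          (x := 4) (y := 5) (by rw [k3]; exact hu) hk 0 2
        rw [k2, k3] at he
        by_cases h : (Expr.cell 0 2 4 5).eval t = 0
        · rw [den_ite_of_eq_zero h, den]
          refine ⟨by simpa using k1, by simpa using k2, by simpa using k3, ?_⟩
          simp only [Store.setReg_reg]
          simp
          exact .inr ⟨_, le_rfl, he.1 h⟩
        · rw [den_ite_of_ne_zero h, den]
          refine ⟨by simpa using k1, by simpa using k2, by simpa using k3, ?_⟩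
          simp only [Store.setReg_reg]
          rw [if_neg (by omega), k4]
          refine or_congr_right ⟨fun ⟨v, hv, h⟩ => ⟨v, by omega, h⟩, fun ⟨v, hv, h'⟩ => ?_⟩
          rcases Nat.lt_succ_iff_lt_or_eq.1 hv with hv | rfl
          · exact ⟨v, hv, h'⟩
          · exact absurd (he.2 h') h)
    rw [h0'] at this
    exact this.2.2.2
  have := den_loop_induction (i := 4)
    (c := .loop 5 (.ite (.cell 0 2 4 5) .skip (.assign 2 (.const 1))))
    (s := s) (fun k t => t.reg 0 = n ∧ t.reg 1 = n * n ∧ t.arr = s.arr ∧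
      (t.reg 2 ≠ 0 ↔ s.reg 2 ≠ 0 ∨ ∃ u < k, ∃ v < n, Alive n s.arr 0 2 u v))
    (by simp [h0, h1]) (by
      rintro k t hk h4 ⟨k0, k1, k2, k3⟩
      rw [h0] at hk
      have := inner k hk t k1 k2 k0 h4
      refine ⟨?_, ?_, ?_, ?_⟩
      · rw [Store.setReg_reg_of_ne _ _ (by omega), den_reg rfl, k0]
      · rw [Store.setReg_reg_of_ne _ _ (by omega), den_reg rfl, k1]
      · rw [Store.setReg_arr, ← k2]
        ext a : 1
        exact den_arr rfl t
      · rw [Store.setReg_reg_of_ne _ _ (by omega), this, k3, or_assoc]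
        refine or_congr_right ⟨?_, ?_⟩
        · rintro (⟨u, hu, h⟩ | h)
          · exact ⟨u, by omega, h⟩
          · exact ⟨k, by omega, h⟩
        · rintro ⟨u, hu, h⟩
          rcases Nat.lt_succ_iff_lt_or_eq.1 hu with hu | rfl
          · exact .inl ⟨u, hu, h⟩
          · exact .inr h)
  rw [h0] at this
  exact this.2.2.2

end Stmt

end

section

/-! ### Counting through the bits -/

/-- The value of the bits at the representatives below `k`, as a binary number. -/
def bitValue (ct mt bit : ℕ → ℕ) : ℕ → ℕ
  | 0 => 0
  | k + 1 => bitValue ct mt bit k +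
      if IsRep ct mt k then bit k * 2 ^ repCount ct mt k else 0

/-- Bits at the representatives below `n`, and zeros elsewhere. -/
def IsBits (n : ℕ) (ct mt bit : ℕ → ℕ) : Prop :=
  (∀ i, bit i ≤ 1) ∧ ∀ i, ¬ (i < n ∧ IsRep ct mt i) → bit i = 0

variable {n : ℕ} {A : ℕ → ℕ → Prop} {ct mt bit bit' : ℕ → ℕ}

theorem repCount_succ (ct mt : ℕ → ℕ) (k : ℕ) :
    repCount ct mt (k + 1) = repCount ct mt k + if IsRep ct mt k then 1 else 0 := by
  rw [repCount, Finset.range_add_one, Finset.filter_insert]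
  split_ifs
  · rw [Finset.card_insert_of_notMem (by simp)]
    rfl
  · rfl

theorem bitValue_lt (h : ∀ i, bit i ≤ 1) (k : ℕ) :
    bitValue ct mt bit k < 2 ^ repCount ct mt k := by
  induction k with
  | zero => simp [bitValue]
  | succ k ih =>
    rw [bitValue, repCount_succ]
    have := h k
    split_ifs
    · rw [pow_succ]
      have : bit k * 2 ^ repCount ct mt k ≤ 1 * 2 ^ repCount ct mt k := Nat.mul_le_mul_right _ this
      omega
    · simpa using ih

theorem bitValue_congr {k : ℕ} (h : ∀ i < k, bit i = bit' i) :
    bitValue ct mt bit k = bitValue ct mt bit' k := by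
  induction k with
  | zero => rfl
  | succ k ih => rw [bitValue, bitValue, ih fun i hi => h i (by omega), h k (by omega)]

theorem bitValue_zero (k : ℕ) : bitValue ct mt (fun _ => 0) k = 0 := by
  induction k with
  | zero => rfl
  | succ k ih => simp [bitValue, ih]

theorem bitValue_inj (h : ∀ i, bit i ≤ 1) (h' : ∀ i, bit' i ≤ 1) {k : ℕ}
    (he : bitValue ct mt bit k = bitValue ct mt bit' k) :
    ∀ i < k, IsRep ct mt i → bit i = bit' i := by
  induction k with
  | zero => intro i hi; omega
  | succ k ih =>
    have h1 := bitValue_lt (ct := ct) (mt := mt) h k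
    have h2 := bitValue_lt (ct := ct) (mt := mt) h' k
    have h3 := h k
    have h4 := h' k
    simp only [bitValue] at he
    have key : (IsRep ct mt k → bit k = bit' k) ∧
        bitValue ct mt bit k = bitValue ct mt bit' k := by
      split_ifs at he with hk
      · have : (bit k = 0 ∨ bit k = 1) ∧ (bit' k = 0 ∨ bit' k = 1) := by omega
        obtain ⟨h5 | h5, h6 | h6⟩ := this <;> rw [h5, h6] at he <;>
          exact ⟨fun _ => by omega, by omega⟩
      · exact ⟨fun h => absurd h hk, by omega⟩
    intro i hi hrep
    rcases Nat.lt_succ_iff_lt_or_eq.1 hi with hi | rfl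
    · exact ih key.2 i hi hrep
    · exact key.1 hrep

theorem IsBits.eq_of_bitValue_eq (h : IsBits n ct mt bit) (h' : IsBits n ct mt bit')
    (he : bitValue ct mt bit n = bitValue ct mt bit' n) : bit = bit' := by
  ext i
  by_cases hi : i < n ∧ IsRep ct mt i
  · exact bitValue_inj h.1 h'.1 he i hi.1 hi.2
  · rw [h.2 i hi, h'.2 i hi]

namespace Stmt

/-- The vertex in register `4` carries a bit. -/
def isRep : Expr :=
  .and (.entry 2 4) (.and (.not (.eq (.entry 2 4) (.succ (.var 4)))) (.lt (.var 4) (.entry 3 4)))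

/-- Add one to the binary number; register `3` is `1` in the end if there is an overflow. -/
def increment : Stmt :=
  .seq (.assign 3 (.const 1)) (.loop 4 (.ite (.and (.var 3) isRep)
    (.ite (.entry 4 4) (.write 4 (.var 4) (.const 0))
      (.seq (.write 4 (.var 4) (.const 1)) (.assign 3 (.const 0)))) .skip))

theorem isRep_eval (s : Store) :
    isRep.eval s = 0 ↔ ¬ IsRep (s.arr 2) (s.arr 3) (s.reg 4) := by
  simp only [isRep, IsRep, Expr.and_eval, Expr.not_eval, Expr.eq_eval, Expr.lt_eval, entry_eval,
    Expr.succ_eval, Expr.var_eval, Ne, not_not]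

theorem increment_spec {s : Store} (hn : s.reg 0 = n) (hct : s.arr 2 = ct) (hmt : s.arr 3 = mt)
    (hb : IsBits n ct mt (s.arr 4)) :
    IsBits n ct mt ((increment.den s).arr 4) ∧
    bitValue ct mt ((increment.den s).arr 4) n + (increment.den s).reg 3 * 2 ^ repCount ct mt n =
      bitValue ct mt (s.arr 4) n + 1 := by
  -- Below the current position, the new value and the weight of the carry make up the old value
  -- plus one.
  have := den_loop_induction (i := 4) (c := .ite (.and (.var 3) isRep)
    (.ite (.entry 4 4) (.write 4 (.var 4) (.const 0))
      (.seq (.write 4 (.var 4) (.const 1)) (.assign 3 (.const 0)))) .skip) (s := s.setReg 3 1)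
    (fun k t => t.arr 2 = ct ∧ t.arr 3 = mt ∧ IsBits n ct mt (t.arr 4) ∧
      (∀ j, k ≤ j → t.arr 4 j = s.arr 4 j) ∧ t.reg 3 ≤ 1 ∧
      bitValue ct mt (t.arr 4) k + t.reg 3 * 2 ^ repCount ct mt k =
        bitValue ct mt (s.arr 4) k + 1)
    (by simp [hct, hmt, hb, bitValue, repCount]) (by
      rintro k t hk h4 ⟨h2, h3, h5, h6, h7, h8⟩
      replace hk : k < n := by simpa [hn] using hk
      have he : (Expr.and (.var 3) isRep).eval t = 0 ↔ ¬ (t.reg 3 ≠ 0 ∧ IsRep ct mt k) := by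
        simp only [Expr.and_eval, Expr.var_eval, Ne, isRep_eval, not_not, h2, h3, h4]
      by_cases hc : (Expr.and (.var 3) isRep).eval t = 0
      · have hc' := he.1 hc
        rw [den_ite_of_eq_zero hc, den]
        refine ⟨h2, h3, h5, fun j hj => h6 j (by omega), h7, ?_⟩
        simp only [bitValue, repCount_succ, Store.setReg_arr, h6 k le_rfl]
        rw [Store.setReg_reg_of_ne _ _ (by omega)]
        by_cases hr : IsRep ct mt k
        · have h9 : t.reg 3 = 0 := by by_contra h; exact hc' ⟨h, hr⟩
          rw [if_pos hr, h9, zero_mul]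
          rw [h9, zero_mul] at h8
          omega
        · rw [if_neg hr, if_neg hr, add_zero, add_zero, add_zero]
          exact h8
      · obtain ⟨hc', hr⟩ := not_not.1 (fun h => hc (he.2 h))
        have h9 : t.reg 3 = 1 := by omega
        have hbk := h5.1 k
        rw [den_ite_of_ne_zero hc]
        have hupd : ∀ b ≤ 1, IsBits n ct mt (Function.update (t.arr 4) k b) := by
          intro b hb
          refine ⟨fun i => ?_, fun i hi => ?_⟩
          · rw [Function.update_apply]
            split_ifs
            · exact hb
            · exact h5.1 i
          · rw [Function.update_of_ne (by rintro rfl; exact hi ⟨hk, hr⟩)]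
            exact h5.2 i hi
        have hval : ∀ b, bitValue ct mt (Function.update (t.arr 4) k b) k =
            bitValue ct mt (t.arr 4) k :=
          fun b => bitValue_congr fun i hi => Function.update_of_ne (by omega) _ _
        have hoff : ∀ b j, k + 1 ≤ j → Function.update (t.arr 4) k b j = s.arr 4 j := by
          intro b j hj
          rw [Function.update_of_ne (by omega), h6 j (by omega)]
        rw [h9, one_mul] at h8
        have hsk := h6 k le_rfl
        by_cases hz : (Expr.entry 4 4).eval t = 0
        · rw [den_ite_of_eq_zero hz]
          rw [entry_eval, h4] at hz
          have e2 : ((seq (write 4 (.var 4) (.const 1)) (assign 3 (.const 0))).den t).arr 4 =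
              Function.update (t.arr 4) k 1 := by simp [den, h4]
          have e3 :
              ((seq (write 4 (.var 4) (.const 1)) (assign 3 (.const 0))).den t).reg 3 = 0 := by
            simp [den]
          refine ⟨by rw [Store.setReg_arr, den_arr rfl, h2],
            by rw [Store.setReg_arr, den_arr rfl, h3], ?_, ?_, ?_, ?_⟩
          · rw [Store.setReg_arr, e2]; exact hupd 1 le_rfl
          · rw [Store.setReg_arr, e2]; exact hoff 1
          · rw [Store.setReg_reg_of_ne _ _ (by omega), e3]; omega
          · rw [Store.setReg_arr, e2, Store.setReg_reg_of_ne _ _ (by omega), e3]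
            simp only [bitValue, repCount_succ, hval, Function.update_self, ← hsk, hz, if_pos hr]
            omega
        · rw [den_ite_of_ne_zero hz]
          rw [entry_eval, h4] at hz
          have e2 : ((write 4 (.var 4) (.const 0)).den t).arr 4 =
              Function.update (t.arr 4) k 0 := by simp [den, h4]
          have e3 : ((write 4 (.var 4) (.const 0)).den t).reg 3 = 1 := by simp [den, h9]
          refine ⟨by rw [Store.setReg_arr, den_arr rfl, h2],
            by rw [Store.setReg_arr, den_arr rfl, h3], ?_, ?_, ?_, ?_⟩
          · rw [Store.setReg_arr, e2]; exact hupd 0 (by omega)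
          · rw [Store.setReg_arr, e2]; exact hoff 0
          · rw [Store.setReg_reg_of_ne _ _ (by omega), e3]
          · have hbk1 : t.arr 4 k = 1 := by omega
            rw [Store.setReg_arr, e2, Store.setReg_reg_of_ne _ _ (by omega), e3]
            simp only [bitValue, repCount_succ, hval, Function.update_self, ← hsk, hbk1, if_pos hr,
              pow_succ]
            omega)
  have hreg : (s.setReg 3 1).reg 0 = n := by simp [hn]
  rw [hreg] at this
  exact ⟨this.2.2.1, this.2.2.2.2.2⟩

/-! ### The algorithm -/

/-- Treat one choice of bits, and proceed to the next one. -/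
def tryBits : Stmt := .seq initTable (.seq closeTable (.seq checkTable increment))

/-- Some colouring that describes an independent cut uses no colour that the bits forbid. -/
def Succeeds (n : ℕ) (A : ℕ → ℕ → Prop) (ct mt bit : ℕ → ℕ) : Prop :=
  ∃ f : ℕ → ℕ, (∀ u < n, f u < 3) ∧ (∀ u < n, ∀ v < n, Allowed A ct mt bit (f u) (f v) u v) ∧
    ∃ u < n, ∃ v < n, f u = 0 ∧ f v = 2

theorem tryBits_spec (hA : IsGraph n A) {s : Store} (hs : Base n (HasMatrix n A) s)
    (hct : s.arr 2 = ct) (hmt : s.arr 3 = mt) (hbit : s.arr 4 = bit) (hW : IsWindmills n A ct mt)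
    (hM : IsMaximal A ct) (hb : IsBits n ct mt bit) :
    Base n (HasMatrix n A) (tryBits.den s) ∧ (tryBits.den s).arr 2 = ct ∧
    (tryBits.den s).arr 3 = mt ∧ IsBits n ct mt ((tryBits.den s).arr 4) ∧
    bitValue ct mt ((tryBits.den s).arr 4) n + (tryBits.den s).reg 3 * 2 ^ repCount ct mt n =
      bitValue ct mt bit n + 1 ∧
    (s.reg 2 ≠ 0 → (tryBits.den s).reg 2 ≠ 0) ∧
    (Succeeds n A ct mt bit → (tryBits.den s).reg 2 ≠ 0) ∧
    ((tryBits.den s).reg 2 ≠ 0 → s.reg 2 ≠ 0 ∨ CutColorable n A) := by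
  have hden : tryBits.den s =
      increment.den (checkTable.den (closeTable.den (initTable.den s))) := rfl
  obtain ⟨i1, i2⟩ := initTable_spec (A := A) s.arr ⟨hs.1, hs.2.1, hs.2.2, fun _ _ => rfl⟩
  rw [hct, hmt, hbit] at i2
  obtain ⟨c1, c2⟩ := closeTable_spec (A := A) (ct := ct) (mt := mt) (bit := bit)
    (s := initTable.den s) ⟨i1.1, i1.2.1, i1.2.2.1,
      fun a ha b hb u hu v hv => (i2 a ha b hb u hu v hv).1,
      fun f hf hfa u hu v hv => (i2 _ (hf u hu) _ (hf v hv) u hu v hv).2 (hfa u hu v hv)⟩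
  have k := checkTable_spec (A := A) (s := closeTable.den (initTable.den s))
    ⟨c1.1, c1.2.1, c1.2.2.1⟩
  have e2 : (closeTable.den (initTable.den s)).reg 2 = s.reg 2 := by
    rw [den_reg rfl, den_reg rfl]
  rw [e2] at k
  have hinc := increment_spec (n := n) (ct := ct) (mt := mt)
    (s := checkTable.den (closeTable.den (initTable.den s)))
    (by rw [den_reg rfl, den_reg rfl, den_reg rfl, hs.1])
    (by rw [den_arr rfl, den_arr rfl, den_arr rfl, hct])
    (by rw [den_arr rfl, den_arr rfl, den_arr rfl, hmt])
    (by rw [den_arr rfl, den_arr rfl, den_arr rfl, hbit]; exact hb)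
  rw [← hden] at hinc
  have e4 : (checkTable.den (closeTable.den (initTable.den s))).arr 4 = bit := by
    rw [den_arr rfl, den_arr rfl, den_arr rfl, hbit]
  rw [e4] at hinc
  have hr2 : (tryBits.den s).reg 2 ≠ 0 ↔ s.reg 2 ≠ 0 ∨ ∃ u < n, ∃ v < n,
      Alive n (closeTable.den (initTable.den s)).arr 0 2 u v := by
    rw [← k, hden, den_reg (c := increment) rfl]
  refine ⟨⟨(den_reg rfl s).trans hs.1, (den_reg rfl s).trans hs.2.1,
    hs.2.2.congr (den_arr rfl s) (den_arr rfl s)⟩, (den_arr rfl s).trans hct,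
    (den_arr rfl s).trans hmt, hinc.1, hinc.2, fun h => hr2.2 (.inl h), ?_, ?_⟩
  · rintro ⟨f, hf3, hfa, u, hu, v, hv, hfu, hfv⟩
    refine hr2.2 (.inr ⟨u, hu, v, hv, ?_⟩)
    have := c1.2.2.2.2 f hf3 hfa u hu v hv
    rwa [hfu, hfv] at this
  · intro h
    rcases hr2.1 h with h | ⟨u, hu, v, hv, h⟩
    · exact .inl h
    · exact .inr (cutColorable_of_consistent hA hW hM c2 c1.2.2.2.1 hu hv h)

/-- The loop over all choices of bits. -/
def tryAllBits : Program := .loop (.eq (.var 3) (.const 0)) tryBits.compile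

/-- The bits run through all binary numbers, starting from that in the memory, so that all choices
of bits with smaller values have been tried. -/
theorem tryAllBits_run (hA : IsGraph n A) (hW : IsWindmills n A ct mt) (hM : IsMaximal A ct)
    (m : ℕ) {s : Store} (hs : Base n (HasMatrix n A) s) (hct : s.arr 2 = ct) (hmt : s.arr 3 = mt)
    (hb : IsBits n ct mt (s.arr 4)) (h3 : s.reg 3 = 0)
    (hm : bitValue ct mt (s.arr 4) n + m = 2 ^ repCount ct mt n)
    (hsound : s.reg 2 ≠ 0 → CutColorable n A)
    (hcomplete : ∀ bit, IsBits n ct mt bit →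
      bitValue ct mt bit n < bitValue ct mt (s.arr 4) n → Succeeds n A ct mt bit → s.reg 2 ≠ 0) :
    ∃ s' t, Run tryAllBits s s' t ∧ t ≤ m * (tryBits.time.eval n + 4) + 4 ∧
      (s'.reg 2 ≠ 0 ↔ CutColorable n A) := by
  induction m generalizing s with
  | zero =>
    have := bitValue_lt (ct := ct) (mt := mt) hb.1 n
    omega
  | succ m ih =>
    obtain ⟨t, ht, hle⟩ := run_compile (c := tryBits) rfl rfl s
    rw [hs.1] at hle
    obtain ⟨k1, k2, k3, k4, k5, k6, k7, k8⟩ := tryBits_spec hA hs hct hmt rfl hW hM hb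
    have hsound' : (tryBits.den s).reg 2 ≠ 0 → CutColorable n A :=
      fun h => (k8 h).elim hsound id
    have hcomplete' : ∀ bit, IsBits n ct mt bit →
        bitValue ct mt bit n < bitValue ct mt (s.arr 4) n + 1 →
        Succeeds n A ct mt bit → (tryBits.den s).reg 2 ≠ 0 := by
      intro bit hbit hlt hsucc
      rcases Nat.lt_succ_iff_lt_or_eq.1 hlt with hlt | heq
      · exact k6 (hcomplete bit hbit hlt hsucc)
      · rw [hbit.eq_of_bitValue_eq hb heq] at hsucc
        exact k7 hsucc
    have he : (Expr.eq (.var 3) (.const 0)).eval s ≠ 0 := by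
      rw [Ne, Expr.eq_eval, Expr.var_eval, Expr.const_eval, h3]
      simp
    have hlt := bitValue_lt (ct := ct) (mt := mt) k4.1 n
    by_cases hz : (tryBits.den s).reg 3 = 0
    · rw [hz, zero_mul, add_zero] at k5
      obtain ⟨s', t', ht', hle', hs'⟩ := ih k1 k2 k3 k4 hz (by omega) hsound'
        (fun bit hbit hlt hsucc => hcomplete' bit hbit (by omega) hsucc)
      refine ⟨s', _, Run.loopStep he ht ht', ?_, hs'⟩
      simp only [Expr.cost]
      rw [add_mul]
      omega
    · -- An overflow only occurs after the last choice of bits.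
      have hlast : 2 ^ repCount ct mt n ≤ bitValue ct mt (s.arr 4) n + 1 := by
        rw [← k5]
        have := Nat.mul_le_mul_right (2 ^ repCount ct mt n) (Nat.one_le_iff_ne_zero.2 hz)
        omega
      have hdone : (Expr.eq (.var 3) (.const 0)).eval (tryBits.den s) = 0 := by
        rw [Expr.eq_eval]
        exact hz
      refine ⟨_, _, Run.loopStep he ht (Run.loopDone hdone), ?_, hsound', ?_⟩
      · simp only [Expr.cost]
        rw [add_mul]
        omega
      · rintro ⟨f, hf, hfuv⟩
        obtain ⟨bit, hb1, hb2, hb3⟩ := hf.exists_bits hA hW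
        have := bitValue_lt (ct := ct) (mt := mt) hb1 n
        exact hcomplete' bit ⟨hb1, hb2⟩ (by omega) ⟨f, hf.lt, hb3, hfuv⟩

/-- Find windmills, try all choices of bits, and put the answer into register `0`. -/
def algorithm : Program :=
  .seq (seq setup findWindmills).compile
    (.seq tryAllBits (.ite (.var 2) (.assign 0 (.const 1)) (.assign 0 (.const 0))))

end Stmt

open Stmt

/-- The algorithm halts in `2 ^ k` times polynomial time, where `k` is the number of triangles in
the windmills that it finds. -/
theorem algorithm_decides : ∃ p : Polynomial ℕ, ∀ (Δ n : ℕ) (G : SimpleGraph (Fin n))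
    [DecidableRel G.Adj], G.maxDegree ≤ Δ → ∃ k : ℕ, k * (1 + 2 * (Δ / 2)) ≤ Δ / 2 * n ∧
      DecidesWithin algorithm G ((p.eval n * 2 ^ k : ℕ) : ℝ) := by
  refine ⟨(seq setup findWindmills).time + (tryBits.time + 4) + 8, fun Δ n G _ hΔ => ?_⟩
  have hA := natAdj_isGraph G
  obtain ⟨t, ht, hle⟩ := run_compile (c := seq setup findWindmills) rfl rfl (input G)
  have hin0 : (input G).reg 0 = n := rfl
  have hin1 : (input G).reg 1 = 0 := rfl
  have hset := setup_spec hin1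
  rw [hin0] at hset hle
  have hmat : HasMatrix n (natAdj G) (setup.den (input G)).arr := by
    refine ⟨hset.2, fun u hu v hv => ?_⟩
    rw [den_arr rfl]
    simp only [input, true_and, ite_eq_right_iff, one_ne_zero, imp_false, not_iff_not]
    constructor
    · rintro ⟨i, j, hk, hij⟩
      obtain ⟨rfl, rfl⟩ := pair_inj hv j.2 hk
      exact ⟨i, j, rfl, rfl, hij⟩
    · rintro ⟨i, j, rfl, rfl, hij⟩
      exact ⟨i, j, rfl, hij⟩
  have hzero : ∀ q, q ≠ 0 → (input G).arr q = fun _ => 0 := by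
    intro q hq
    ext k
    simp [input, hq]
  obtain ⟨f1, f2⟩ := findWindmills_spec hA (s := setup.den (input G))
    ⟨by rw [den_reg rfl, hin0], hset.1, hmat, by
      rw [den_arr rfl, den_arr rfl, hzero 2 (by omega), hzero 3 (by omega)]
      exact ⟨by simp, by simp, by simp⟩⟩
  set s := findWindmills.den (setup.den (input G)) with hs
  have h4 : s.arr 4 = fun _ => 0 := by rw [hs, den_arr rfl, den_arr rfl, hzero 4 (by omega)]
  have h2 : s.reg 2 = 0 := by rw [hs, den_reg rfl, den_reg rfl]; rfl
  have h3 : s.reg 3 = 0 := by rw [hs, den_reg rfl, den_reg rfl]; rfl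
  obtain ⟨s', t', ht', hle', hs'⟩ := tryAllBits_run hA f1.2.2.2 f2
    (2 ^ repCount (s.arr 2) (s.arr 3) n) (s := s) ⟨f1.1, f1.2.1, f1.2.2.1⟩ rfl rfl
    (by rw [h4]; exact ⟨fun _ => Nat.zero_le _, fun _ _ => rfl⟩) h3
    (by rw [h4, bitValue_zero, zero_add]) (fun h => absurd h2 h)
    (by rw [h4, bitValue_zero]; intro bit _ h; omega)
  refine ⟨repCount (s.arr 2) (s.arr 3) n, f1.2.2.2.repCount_le hA ?_, ?_⟩
  · intro c hc S hS
    refine le_trans ?_ ((G.degree_le_maxDegree ⟨c, hc⟩).trans hΔ)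
    rw [← SimpleGraph.card_neighborFinset_eq_degree, ← Finset.card_map Fin.valEmbedding]
    apply Finset.card_le_card
    intro x hx
    obtain ⟨i, j, hi, rfl, hij⟩ := hS x hx
    rw [Finset.mem_map]
    refine ⟨j, ?_, rfl⟩
    rw [SimpleGraph.mem_neighborFinset, show (⟨c, hc⟩ : Fin n) = i from Fin.ext hi]
    exact hij
  · set K := 2 ^ repCount (s.arr 2) (s.arr 3) n with hK
    have hK1 : 1 ≤ K := Nat.one_le_two_pow
    have hbound : t + (t' + (2 + 2)) ≤
        ((seq setup findWindmills).time + (tryBits.time + 4) + 8).eval n * K := by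
      have e4 : (4 : Polynomial ℕ).eval n = 4 := by simp
      have e8 : (8 : Polynomial ℕ).eval n = 8 := by simp
      rw [Polynomial.eval_add, Polynomial.eval_add, Polynomial.eval_add, e4, e8]
      generalize (seq setup findWindmills).time.eval n = x at *
      generalize tryBits.time.eval n = y at *
      nlinarith
    rw [DecidesWithin, hasIndependentCut_iff, ← hs']
    by_cases h : s'.reg 2 = 0
    · refine ⟨_, _, ht.seq (ht'.seq (Run.iteFalse h (Run.assign 0 (.const 0) s'))), ?_,
        .inr ⟨by simpa using h, by simp⟩⟩
      exact_mod_cast hbound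
    · refine ⟨_, _, ht.seq (ht'.seq (Run.iteTrue h (Run.assign 0 (.const 1) s'))), ?_,
        .inl ⟨h, by simp⟩⟩
      exact_mod_cast hbound

theorem DecidesWithin.mono {P : Program} {n : ℕ} {G : SimpleGraph (Fin n)} [DecidableRel G.Adj]
    {T T' : ℝ} (h : DecidesWithin P G T) (hT : T ≤ T') : DecidesWithin P G T' := by
  obtain ⟨s, t, h1, h2, h3⟩ := h
  exact ⟨s, t, h1, h2.trans hT, h3⟩

theorem le_exponent {k n Δ : ℕ} (h : k * (1 + 2 * (Δ / 2)) ≤ Δ / 2 * n) :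
    (k : ℝ) ≤ (1 / 2 - alpha Δ) * n := by
  have h' : (k : ℝ) * (1 + 2 * ((Δ / 2 : ℕ) : ℝ)) ≤ ((Δ / 2 : ℕ) : ℝ) * n := by exact_mod_cast h
  have hd : (0 : ℝ) ≤ ((Δ / 2 : ℕ) : ℝ) := Nat.cast_nonneg _
  rw [alpha]
  generalize ((Δ / 2 : ℕ) : ℝ) = d at *
  have : (1 / 2 - 1 / (2 + 4 * d)) * n = d * n / (1 + 2 * d) := by
    field_simp
    ring
  rw [this, le_div_iff₀ (by positivity)]
  exact h'

end

end IndependentCut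

/-- One program decides the existence of an independent cut on all graphs; the polynomial factors
depend neither on the graph nor on `Δ`. -/
theorem corollary3 :
    ∃ P : IndependentCut.Program,
      (∃ p : Polynomial ℕ, ∀ (Δ n : ℕ) (G : SimpleGraph (Fin n)) [DecidableRel G.Adj],
        G.maxDegree ≤ Δ →
          IndependentCut.DecidesWithin P G
            (((p.eval n : ℕ) : ℝ) *
              (2 : ℝ) ^ ((1 / 2 - IndependentCut.alpha Δ) * (n : ℝ)))) ∧
      (∃ p : Polynomial ℕ, ∀ (n : ℕ) (G : SimpleGraph (Fin n)) [DecidableRel G.Adj],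
        IndependentCut.DecidesWithin P G (((p.eval n : ℕ) : ℝ) * (√2 : ℝ) ^ n)) := by
  obtain ⟨p, hp⟩ := IndependentCut.algorithm_decides
  refine ⟨IndependentCut.Stmt.algorithm, ⟨p, fun Δ n G _ hΔ => ?_⟩, ⟨p, fun n G _ => ?_⟩⟩
  · obtain ⟨k, hk, h⟩ := hp Δ n G hΔ
    refine h.mono ?_
    push_cast
    refine mul_le_mul_of_nonneg_left ?_ (by positivity)
    rw [← Real.rpow_natCast]
    exact Real.rpow_le_rpow_of_exponent_le one_le_two (IndependentCut.le_exponent hk)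
  · obtain ⟨k, hk, h⟩ := hp G.maxDegree n G le_rfl
    refine h.mono ?_
    push_cast
    refine mul_le_mul_of_nonneg_left ?_ (by positivity)
    have h2k : k * 2 ≤ n := by
      by_contra hcon
      have hk0 : 0 < k := by omega
      have := Nat.mul_le_mul_left (G.maxDegree / 2) (show n + 1 ≤ k * 2 by omega)
      generalize G.maxDegree / 2 = d at *
      nlinarith
    calc (2 : ℝ) ^ k = √2 ^ (2 * k) := by rw [pow_mul, Real.sq_sqrt zero_le_two]
      _ ≤ √2 ^ n := pow_le_pow_right₀ (Real.one_le_sqrt.2 one_le_two) (by omega)
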